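/- For $n\ge 1$ let $L_n$ be the (unoriented) link given by the following alternating diagram with $n+4$ crossings $a,b,c,d,e_1,\dots,e_n$. The crossings $a$ and $b$ are joined by two parallel edges that bound a bigonal face (a \emph{lens}); $a$ and $b$ are both joined by an edge to $c$, on the left, and to $d$, on the right; below $b$ there is a vertical chain of lenses through $e_1,\dots,e_n$ (that is, $e_i$ and $e_{i+1}$ span a lens for $1\le i<n$), where the two upper ends of $e_1$ go to $c$ and $d$, and the two lower ends of $e_n$ go to $c$ and $d$. So $L_1$ is the knot $5_2$, and $L_n$ arises from its diagram by replacing the bottom crossing $e_1$ by a vertical twist with $n$ crossings; $L_2,L_3,L_4,L_5$ are $L6a1$, $7_5$, $L8a11$, $9_6$. A \emph{plane Lombardi drawing} of a plane multigraph is a drawing in the Euclidean plane, with the same counterclockwise order of the edges at each vertex, in which the vertices are distinct points, the edges are circular arcs or line segments that contain no vertices in their interiors, no two edges meet except at common end vertices, and the edges at each vertex are equiangularly spaced. \textbf{Corollary.} Every member $L_n$ of this family whose above diagram has six or more vertices (that is, $n\ge 2$) has a diagram, again with $n+4$ crossings, whose underlying $4$-regular plane multigraph is connected, has no loops and no cut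 vertices, and has a plane Lombardi drawing. -/

import Mathlib

/-!
# Link diagrams as planar-diagram codes, Reidemeister equivalence, plane Lombardi drawings
-/

namespace LombardiKnots

/-- A vertex of a link diagram, together with the labels of the edge ends at it.
`crossing a b c d`: a crossing whose four ends carry the labels `a, b, c, d` in counterclockwise
order; the strand through `a` and `c` passes under the strand through `b` and `d`.
`joint a b`: a marked point on a strand, joining the edges `a` and `b`. -/
inductive Piece : Type
  | crossing (a b c d : ℕ) : Piece
  | joint (a b : ℕ) : Piece

/-- The labels of the ends, in counterclockwise order. -/
def Piece.ends : Piece → List ℕ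
  | .crossing a b c d => [a, b, c, d]
  | .joint a b => [a, b]

def Piece.IsCrossing : Piece → Prop
  | .crossing _ _ _ _ => True
  | .joint _ _ => False

def Piece.relabel (f : ℕ → ℕ) : Piece → Piece
  | .crossing a b c d => .crossing (f a) (f b) (f c) (f d)
  | .joint a b => .joint (f a) (f b)

/-- A planar-diagram code: two ends with the same label are the two ends of one edge.
(A crossingless closed curve is a cycle of joints, for instance `[joint a a]`.) -/
abbrev Code : Type := List Piece

namespace Code

def labels (L : Code) : List ℕ := L.flatMap Piece.ends

/-- Every edge has exactly two ends. -/
def Valid (L : Code) : Prop := ∀ x ∈ L.labels, L.labels.count x = 2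

/-- The label of the end number `e.2` of the piece number `e.1`. -/
def endLabel (L : Code) (e : ℕ × ℕ) : Option ℕ :=
  (L[e.1]?).bind fun p => p.ends[e.2]?

/-- The pairs `e` and `e'` are the two distinct ends of one edge. -/
def Mates (L : Code) (e e' : ℕ × ℕ) : Prop :=
  e ≠ e' ∧ ∃ x, L.endLabel e = some x ∧ L.endLabel e' = some x

/-- The corner `(i, k)` is the angular sector at piece `i` between end `k` and the end that follows
it counterclockwise. Two corners are consecutive along the boundary of a face if one gets from the
first to the second by running along the edge which leaves piece `i` at that following end, keeping
the face on the right. -/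
def NextCorner (L : Code) (c c' : ℕ × ℕ) : Prop :=
  ∃ p, L[c.1]? = some p ∧ L.Mates (c.1, (c.2 + 1) % p.ends.length) c'

/-- The two corners belong to the same boundary walk of a face. -/
def SameFace (L : Code) : ℕ × ℕ → ℕ × ℕ → Prop := Relation.EqvGen L.NextCorner

/-- The pieces number `i` and `j` are joined by an edge. -/
def Adj (L : Code) (i j : ℕ) : Prop := ∃ k m, L.Mates (i, k) (j, m)

/-- The pieces number `i` and `j` lie in the same connected component of the diagram. -/
def Joined (L : Code) : ℕ → ℕ → Prop := Relation.EqvGen L.Adj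

/-- Elementary changes of a diagram. The first five only change its encoding, the others are the
Reidemeister moves (each of them is applied in either direction, see `Equivalent`). -/
inductive Move : Code → Code → Prop
  | perm {L L' : Code} : L.Perm L' → Move L L'
  | relabel (L : Code) (f : ℕ → ℕ) : Function.Injective f → Move L (L.map (Piece.relabel f))
  | rotateCrossing (a b c d : ℕ) (L : Code) :
      Move (.crossing a b c d :: L) (.crossing c d a b :: L)
  | rotateJoint (a b : ℕ) (L : Code) : Move (.joint a b :: L) (.joint b a :: L)
  /-- A marked point on a strand is forgotten. -/
  | forgetJoint (a b : ℕ) (L : Code) : a ≠ b →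
      Move (.joint a b :: L) (L.map (Piece.relabel (Function.update id b a)))
  /-- First Reidemeister move: a kink is removed. -/
  | r1 (i a b : ℕ) (L : Code) : Move (.crossing i i a b :: L) (.joint a b :: L)
  | r1' (i a b : ℕ) (L : Code) : Move (.crossing a i i b :: L) (.joint a b :: L)
  /-- Second Reidemeister move. Two strands that run next to each other, one from `a` up to `b`, the
  other, to its right, from `c` up to `d`: the first is pushed to the right over the second. The two
  strands have to border the same face, unless they lie in different components of the diagram
  (these can be moved next to each other). -/
  | r2 (a b c d m n : ℕ) (L : Code) :
      (SameFace (.joint a b :: .joint d c :: L) (0, 0) (1, 0) ∨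
        ¬ Joined (.joint a b :: .joint d c :: L) 0 1) →
      Move (.joint a b :: .joint d c :: L) (.crossing c m n a :: .crossing n m d b :: L)
  /-- Third Reidemeister move: the strands join the opposite ones of six points
  `b₀, …, b₅`, which lie counterclockwise on a circle. The strand from `b₀` to `b₃` is moved across
  the crossing of the other two, over both of them; here `b₂b₅` passes over `b₁b₄`. -/
  | r3 (b₀ b₁ b₂ b₃ b₄ b₅ p q r : ℕ) (L : Code) :
      Move (.crossing b₁ b₂ q r :: .crossing r p b₅ b₀ :: .crossing q b₃ b₄ p :: L)
        (.crossing q r b₄ b₅ :: .crossing b₁ p q b₀ :: .crossing b₂ b₃ r p :: L)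
  /-- The same move in the case that `b₁b₄` passes over `b₂b₅`. -/
  | r3' (b₀ b₁ b₂ b₃ b₄ b₅ p q r : ℕ) (L : Code) :
      Move (.crossing b₂ q r b₁ :: .crossing r p b₅ b₀ :: .crossing q b₃ b₄ p :: L)
        (.crossing r b₄ b₅ q :: .crossing b₁ p q b₀ :: .crossing b₂ b₃ r p :: L)

/-- Two diagrams represent the same (unoriented) link: they are connected by a finite sequence of
Reidemeister moves and their inverses. (All moves keep a planar diagram planar.) -/
def Equivalent : Code → Code → Prop :=
  Relation.EqvGen fun L L' => L.Valid ∧ L'.Valid ∧ Move L L'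

/-- A diagram whose underlying 4-regular multigraph is connected, without loops and without
cut vertices. -/
structure IsLinkMultigraph (L : Code) : Prop where
  valid : L.Valid
  fourRegular : ∀ p ∈ L, p.IsCrossing
  loopless : ∀ p ∈ L, p.ends.Nodup
  connected : ∀ i j, i < L.length → j < L.length → L.Joined i j
  no_cut_vertex : ∀ v i j, v < L.length → i < L.length → j < L.length → i ≠ v → j ≠ v →
    Relation.EqvGen (fun x y => x ≠ v ∧ y ≠ v ∧ L.Adj x y) i j

end Code

/-- `γ`, restricted to `[0, 1]`, is a constant speed parametrization of a line segment or of an arc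
of a circle that is less than the full circle. -/
def IsCircularArc (γ : ℝ → ℂ) : Prop :=
  (∃ p v : ℂ, v ≠ 0 ∧ ∀ t : ℝ, γ t = p + t * v) ∨
  (∃ (c : ℂ) (r θ ω : ℝ), 0 < r ∧ 0 < |ω| ∧ |ω| < 2 * Real.pi ∧
    ∀ t : ℝ, γ t = c + r * Complex.exp ((θ + ω * t : ℝ) * Complex.I))

/-- A plane Lombardi drawing of a loopless 4-regular plane multigraph given by the code `L`, with
the combinatorial embedding (the counterclockwise order of the edge ends at each vertex) of `L`.
The arc `arc i k` draws the edge that leaves vertex `i` at its end `k`, starting at vertex `i`. -/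
structure PlaneLombardiDrawing (L : Code) where
  pos : Fin L.length → ℂ
  arc : Fin L.length → Fin 4 → ℝ → ℂ
  pos_injective : Function.Injective pos
  isCircularArc : ∀ i k, IsCircularArc (arc i k)
  arc_zero : ∀ i k, arc i k 0 = pos i
  /-- From its other end, an edge is drawn as the same arc, traversed backwards. -/
  arc_reverse : ∀ (i j : Fin L.length) (k m : Fin 4), L.Mates (i, k) (j, m) →
    ∀ t : ℝ, arc j m t = arc i k (1 - t)
  /-- The interior of an edge contains no vertex. -/
  avoids : ∀ i k j, ∀ t ∈ Set.Ioo (0 : ℝ) 1, arc i k t ≠ pos j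
  /-- Perfect angular resolution: at each vertex the ends leave, in their counterclockwise order, in
  directions that differ by right angles. -/
  angular : ∀ i, ∃ u : ℂ, u ≠ 0 ∧ ∀ k : Fin 4, ∃ s : ℝ, 0 < s ∧
    HasDerivAt (arc i k) (s * (u * Complex.I ^ (k : ℕ))) 0
  /-- Planarity: distinct edges meet at most in their end points. -/
  plane : ∀ (i j : Fin L.length) (k m : Fin 4), L.endLabel (i, k) ≠ L.endLabel (j, m) →
    ∀ s ∈ Set.Icc (0 : ℝ) 1, ∀ t ∈ Set.Icc (0 : ℝ) 1, arc i k s = arc j m t →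
      (s = 0 ∨ s = 1) ∧ (t = 0 ∨ t = 1)

/-- The diagram with `n + 4` vertices `a, b, c, d, e₁, …, eₙ` (in this order), for `n ≥ 1`.
The vertices `a` and `b` span a lens (edges `0`, `1`), and both are adjacent to `c` and `d`
(edges `2`, `3`, `4`, `5`). Below `b` hangs a vertical chain of lenses, a twist `e₁, …, eₙ`, with
`c` to its left and `d` to its right; the two upper ends of `e₁` go to `c` and `d`, and so do the
two lower ends of `eₙ`. The edges of the chain are `6 + 2 i` on the left and `7 + 2 i` on the right.
The diagram is alternating. For `n = 1` it is the standard diagram of the knot `5₂`, whose vertex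
`e₁` is replaced by a vertical twist of `n` crossings in general; `n = 2, 3, 4, 5` give `L6a1`,
`7₅`, `L8a11`, `9₆`. -/
def family (n : ℕ) : Code :=
  [.crossing 2 0 1 3, .crossing 0 4 5 1, .crossing (6 + 2 * n) 6 4 2,
    .crossing 3 5 7 (7 + 2 * n)] ++
  (List.range n).map fun i =>
    .crossing (6 + 2 * i) (6 + 2 * (i + 1)) (7 + 2 * (i + 1)) (7 + 2 * i)

end LombardiKnots

/-! A flype carries `c` across the lens formed by `a` and `b` to the other side, where it spans a
lens with `d`. The result, `flypedFamily n`, has the same number of crossings and the same link type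
(`equivalent_flype`), and it can be drawn explicitly.

The drawing is made on the Riemann sphere, where Möbius maps preserve circles, angles and
orientation. Vertex 3 is put at infinity and vertex 2 at the origin, so that the lens between them
consists of the positive real and the negative imaginary half-axis. Vertices 0 and 1 are `I` and
`-1`, joined by two circular arcs in the second quadrant. The twist sits on the segment from `-8` to
`8 * I`, each of its lenses consisting of two quarter circles. Half circles in the third and first
quadrants and two more rays complete the picture. All directions at finite vertices are
axis-parallel, and the four rays reach infinity at right angles. Inverting about `1 - I`, a point
inside the lens between vertices 2 and 3, gives a drawing in the plane.

Arcs from `p` to `q` are handled through the condition that `(z - p) / (q - z)` is a positive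
multiple of a fixed `u`. Inversion only multiplies `u` by a constant, so the passage to the plane is
algebra (`ModelEdge.ne_zero_and_mem_interior`, `ModelEdge.Leaves.inverted`). Planarity reduces to
enclosing the edges in pairwise disjoint regions that avoid the vertices (`IsModelEdge.isZone`,
`IsZone.unique`, `IsModelVertex.not_isZone`). -/

namespace LombardiKnots

open Complex

/-! ### Circular arcs with given end points and initial direction -/

/-- The circular arc (or line segment) from `p` to `q` that leaves `p` in the direction of
`(q - p) * u`, parametrized by constant speed. -/
noncomputable def circularArc (p q u : ℂ) (t : ℝ) : ℂ :=
  if arg u = 0 then p + t * (q - p)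
  else p + (q - p) *
    ((exp ((-(2 * arg u) * t : ℝ) * I) - 1) / (exp ((-(2 * arg u) : ℝ) * I) - 1))

theorem exp_mul_I_sub_exp_mul_I (x y : ℝ) :
    exp ((2 * x : ℝ) * I) - exp ((2 * y : ℝ) * I) =
      2 * I * (Real.sin (x - y) : ℝ) * exp ((x + y : ℝ) * I) := by
  have hx : exp ((2 * x : ℝ) * I) = exp ((x + y : ℝ) * I) * exp ((x - y : ℝ) * I) := by
    rw [← exp_add]; congr 1; push_cast; ring
  have hy : exp ((2 * y : ℝ) * I) = exp ((x + y : ℝ) * I) * exp ((-(x - y) : ℝ) * I) := by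
    rw [← exp_add]; congr 1; push_cast; ring
  have hs : exp ((x - y : ℝ) * I) - exp ((-(x - y) : ℝ) * I) = 2 * I * (Real.sin (x - y) : ℝ) := by
    rw [exp_ofReal_mul_I, exp_ofReal_mul_I, Real.cos_neg, Real.sin_neg]
    push_cast; ring
  rw [hx, hy, ← mul_sub, hs]; ring

section

variable {p q u : ℂ}

/-- The slit plane excludes argument `π`, for which the "arc" would run along the line through
infinity. The remaining arguments lie in `(-π, π)`, where the sine vanishes only at `0`. -/
theorem sin_arg_ne_zero (hu : u ∈ slitPlane) (h : arg u ≠ 0) : Real.sin (arg u) ≠ 0 := by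
  rw [mem_slitPlane_iff_arg] at hu
  have h1 := arg_le_pi u
  have h2 := neg_pi_lt_arg u
  rw [Ne, Real.sin_eq_zero_iff_of_lt_of_lt h2 (lt_of_le_of_ne h1 hu.1)]
  exact h

theorem exp_two_arg_sub_one (u : ℂ) (t : ℝ) : exp ((-(2 * arg u) * t : ℝ) * I) - 1 =
    -(2 * I * (Real.sin (arg u * t) : ℝ) * exp ((-(arg u * t) : ℝ) * I)) := by
  have := exp_mul_I_sub_exp_mul_I (-(arg u * t)) 0
  simp only [mul_zero, ofReal_zero, zero_mul, exp_zero, sub_zero, add_zero, Real.sin_neg] at this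
  rw [show (-(2 * arg u) * t : ℝ) = 2 * -(arg u * t) by ring, this]
  push_cast; ring

theorem exp_two_arg_ne_one (hu : u ∈ slitPlane) (h : arg u ≠ 0) :
    exp ((-(2 * arg u) : ℝ) * I) - 1 ≠ 0 := by
  have := exp_two_arg_sub_one u 1
  simp only [mul_one] at this
  rw [this]
  simp only [neg_ne_zero, ne_eq, mul_eq_zero, exp_ne_zero, I_ne_zero, OfNat.ofNat_ne_zero, false_or,
    or_false, ofReal_eq_zero]
  exact sin_arg_ne_zero hu h

theorem circularArc_zero : circularArc p q u 0 = p := by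
  simp [circularArc]

theorem circularArc_one (hu : u ∈ slitPlane) : circularArc p q u 1 = q := by
  unfold circularArc
  split_ifs with h
  · simp
  · rw [mul_one, div_self (exp_two_arg_ne_one hu h)]; ring

theorem isCircularArc_circularArc (hu : u ∈ slitPlane) (hpq : p ≠ q) :
    IsCircularArc (circularArc p q u) := by
  by_cases h : arg u = 0
  · exact Or.inl ⟨p, q - p, sub_ne_zero.2 hpq.symm, fun t => by simp [circularArc, h]⟩
  · right
    have hE := exp_two_arg_ne_one hu h
    set k : ℂ := (q - p) / (exp ((-(2 * arg u) : ℝ) * I) - 1) with hk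
    have hk0 : k ≠ 0 := div_ne_zero (sub_ne_zero.2 hpq.symm) hE
    have harg := (mem_slitPlane_iff_arg.1 hu).1
    refine ⟨p - k, ‖k‖, arg k, -(2 * arg u), norm_pos_iff.2 hk0, ?_, ?_, fun t => ?_⟩
    · simpa using h
    · have h1 := lt_of_le_of_ne (arg_le_pi u) harg
      have h2 := neg_pi_lt_arg u
      rw [abs_lt]; constructor <;> linarith
    · have : (‖k‖ : ℂ) * exp ((arg k + -(2 * arg u) * t : ℝ) * I) =
          k * exp ((-(2 * arg u) * t : ℝ) * I) := by
        conv_rhs => rw [← norm_mul_exp_arg_mul_I k]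
        rw [mul_assoc, ← exp_add]; congr 2; push_cast; ring
      rw [this, circularArc, if_neg h, hk]
      field_simp
      ring

/-- With `α = arg u`, the initial velocity is `(q - p) * (α / sin α) * exp (α * I)`, and `α / sin α`
is positive since the sine has the sign of its argument on `(-π, π)`. -/
theorem exists_hasDerivAt_circularArc (hu : u ∈ slitPlane) :
    ∃ s : ℝ, 0 < s ∧ HasDerivAt (circularArc p q u) (s * ((q - p) * u)) 0 := by
  have hu0 : u ≠ 0 := slitPlane_ne_zero hu
  have hn : (0 : ℝ) < ‖u‖ := norm_pos_iff.2 hu0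
  have hnC : (‖u‖ : ℂ) ≠ 0 := by exact_mod_cast hn.ne'
  by_cases h : arg u = 0
  · refine ⟨‖u‖⁻¹, inv_pos.2 hn, ?_⟩
    have hd : HasDerivAt (fun t : ℝ => p + (t : ℂ) * (q - p)) (1 * (q - p)) 0 :=
      ((hasDerivAt_id (0 : ℝ)).ofReal_comp.mul_const (q - p)).const_add p
    have e : circularArc p q u = fun t : ℝ => p + (t : ℂ) * (q - p) := by
      funext t; simp [circularArc, h]
    have hu' : u = ‖u‖ := by
      conv_lhs => rw [← norm_mul_exp_arg_mul_I u, h]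
      simp
    rw [e]
    convert hd using 1
    rw [hu']
    simp
    field_simp
  · have hs := sin_arg_ne_zero hu h
    have hpos : 0 < arg u / Real.sin (arg u) := by
      rcases lt_or_gt_of_ne h with h' | h'
      · exact div_pos_of_neg_of_neg h' (Real.sin_neg_of_neg_of_neg_pi_lt h' (neg_pi_lt_arg u))
      · exact div_pos h' (Real.sin_pos_of_pos_of_lt_pi h'
          (lt_of_le_of_ne (arg_le_pi u) (mem_slitPlane_iff_arg.1 hu).1))
    refine ⟨arg u / Real.sin (arg u) / ‖u‖, div_pos hpos hn, ?_⟩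
    have hE := exp_two_arg_ne_one hu h
    have e : circularArc p q u = fun t : ℝ => p + (q - p) *
        ((exp ((-(2 * arg u) * t : ℝ) * I) - 1) / (exp ((-(2 * arg u) : ℝ) * I) - 1)) := by
      funext t; simp [circularArc, h]
    have hd : HasDerivAt (fun t : ℝ => exp ((-(2 * arg u) * t : ℝ) * I))
        (exp ((-(2 * arg u) * (0 : ℝ) : ℝ) * I) * (((-(2 * arg u) * 1 : ℝ) : ℂ) * I)) 0 :=
      ((((hasDerivAt_id (0 : ℝ)).const_mul (-(2 * arg u))).ofReal_comp).mul_const I).cexp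
    have hd' := (((hd.sub_const 1).div_const (exp ((-(2 * arg u) : ℝ) * I) - 1)).const_mul
      (q - p)).const_add p
    rw [e]
    refine hd'.congr_deriv ?_
    have h1 := exp_two_arg_sub_one u 1
    simp only [mul_one] at h1
    have hx : exp ((-(arg u) : ℝ) * I) * exp ((arg u : ℝ) * I) = 1 := by
      rw [← exp_add]; simp
    have hu' := norm_mul_exp_arg_mul_I u
    have hsC : ((Real.sin (arg u) : ℝ) : ℂ) ≠ 0 := by exact_mod_cast hs
    rw [h1]
    simp only [mul_zero, ofReal_zero, zero_mul, exp_zero, one_mul, mul_one]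
    have hx0 := exp_ne_zero ((-(arg u) : ℝ) * I)
    have hu'' : u = ‖u‖ / exp ((-(arg u) : ℝ) * I) := by
      rw [eq_div_iff hx0]
      linear_combination (‖u‖ : ℂ) * hx - exp ((-(arg u) : ℝ) * I) * hu'
    generalize exp ((-(arg u) : ℝ) * I) = w at *
    push_cast at *
    have key : (arg u : ℂ) / sin (arg u) / ‖u‖ * ((q - p) * (‖u‖ / w)) =
        (q - p) * (-(2 * (arg u : ℂ)) * I / -(2 * I * sin (arg u) * w)) := by
      have := I_ne_zero
      field_simp
    rw [← hu''] at key
    exact key.symm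

/-- Exchanging `p` and `q` inverts the quotient `(z - p) / (q - z)`, hence `u`. -/
theorem circularArc_reverse (hu : u ∈ slitPlane) (t : ℝ) :
    circularArc q p u⁻¹ t = circularArc p q u (1 - t) := by
  have harg := (mem_slitPlane_iff_arg.1 hu).1
  have hinv : arg u⁻¹ = -arg u := by rw [arg_inv, if_neg harg]
  unfold circularArc
  rw [hinv]
  by_cases h : arg u = 0
  · simp [h]; ring
  · rw [if_neg (by simpa using h), if_neg h]
    have hE := exp_two_arg_ne_one hu h
    have h1 : exp ((-(2 * arg u) * (1 - t) : ℝ) * I) =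
        exp ((-(2 * arg u) : ℝ) * I) * exp ((-(2 * -arg u) * t : ℝ) * I) := by
      rw [← exp_add]; congr 1; push_cast; ring
    have h2 : exp ((-(2 * -arg u) : ℝ) * I) = (exp ((-(2 * arg u) : ℝ) * I))⁻¹ := by
      rw [← exp_neg]; congr 1; push_cast; ring
    have h3 := exp_ne_zero ((-(2 * arg u) : ℝ) * I)
    rw [h1, h2]
    generalize exp ((-(2 * arg u) : ℝ) * I) = w at *
    generalize exp ((-(2 * -arg u) * t : ℝ) * I) = v at *
    have h4 : w⁻¹ - 1 ≠ 0 := by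
      intro h5
      apply hE
      have : w⁻¹ = 1 := by linear_combination h5
      rw [inv_eq_one.1 this]; ring
    have h5 : 1 - w ≠ 0 := fun h => hE (by linear_combination -h)
    field_simp
    ring

/-- The interior of a circular arc consists of the points `z` for which `(z - p) / (q - z)` has the
direction of `u`. -/
theorem exists_circularArc_sub_eq (hu : u ∈ slitPlane) {t : ℝ} (ht : t ∈ Set.Ioo (0 : ℝ) 1) :
    ∃ s : ℝ, 0 < s ∧ circularArc p q u t - p = s * u * (q - circularArc p q u t) := by
  have hu0 : u ≠ 0 := slitPlane_ne_zero hu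
  have hn : (0 : ℝ) < ‖u‖ := norm_pos_iff.2 hu0
  have hnC : (‖u‖ : ℂ) ≠ 0 := by exact_mod_cast hn.ne'
  obtain ⟨ht0, ht1⟩ := ht
  have ht1' : 0 < 1 - t := by linarith
  by_cases h : arg u = 0
  · refine ⟨t / (1 - t) / ‖u‖, by positivity, ?_⟩
    have hu' : u = ‖u‖ := by
      conv_lhs => rw [← norm_mul_exp_arg_mul_I u, h]
      simp
    have h2 : ((t / (1 - t) / ‖u‖ : ℝ) : ℂ) * u = t / (1 - t) := by
      conv_lhs => rw [hu']
      push_cast; simp only [norm_norm, norm_real]; field_simp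
    rw [h2, circularArc, if_pos h]
    have : (1 - t : ℂ) ≠ 0 := by exact_mod_cast ht1'.ne'
    field_simp
    ring
  · have hpi := lt_of_le_of_ne (arg_le_pi u) (mem_slitPlane_iff_arg.1 hu).1
    have hpi' := neg_pi_lt_arg u
    have hE := exp_two_arg_ne_one hu h
    -- The law of sines in the triangle `p, z, q`: its angles at `q` and `p` are inscribed angles
    -- proportional to `t` and `1 - t`, so this is the ratio of the distances of `z` from `p` and
    -- `q`.
    have hpos : 0 < Real.sin (arg u * t) / Real.sin (arg u * (1 - t)) := by
      rcases lt_or_gt_of_ne h with h' | h'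
      · apply div_pos_of_neg_of_neg <;> apply Real.sin_neg_of_neg_of_neg_pi_lt <;> nlinarith
      · apply div_pos <;> apply Real.sin_pos_of_pos_of_lt_pi <;> nlinarith
    refine ⟨Real.sin (arg u * t) / Real.sin (arg u * (1 - t)) / ‖u‖, div_pos hpos hn, ?_⟩
    have hs : Real.sin (arg u * (1 - t)) ≠ 0 := by
      intro h0; rw [h0] at hpos; simp at hpos
    have h1 := exp_two_arg_sub_one u t
    have h2 := exp_mul_I_sub_exp_mul_I (-(arg u)) (-(arg u * t))
    rw [show (2 * -(arg u) : ℝ) = -(2 * arg u) by ring,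
      show (2 * -(arg u * t) : ℝ) = -(2 * arg u) * t by ring,
      show (-arg u - -(arg u * t) : ℝ) = -(arg u * (1 - t)) by ring, Real.sin_neg] at h2
    have h3 : exp ((-arg u + -(arg u * t) : ℝ) * I) * exp ((arg u : ℝ) * I) =
        exp ((-(arg u * t) : ℝ) * I) := by
      rw [← exp_add]; congr 1; push_cast; ring
    have hu' := norm_mul_exp_arg_mul_I u
    have hsC : ((Real.sin (arg u * (1 - t)) : ℝ) : ℂ) ≠ 0 := by exact_mod_cast hs
    have key : exp ((-(2 * arg u) * t : ℝ) * I) - 1 =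
        ((Real.sin (arg u * t) / Real.sin (arg u * (1 - t)) / ‖u‖ : ℝ) : ℂ) * u *
        (exp ((-(2 * arg u) : ℝ) * I) - exp ((-(2 * arg u) * t : ℝ) * I)) := by
      rw [h1, h2, ← h3]
      generalize exp ((arg u : ℝ) * I) = w at hu' ⊢
      generalize exp ((-arg u + -(arg u * t) : ℝ) * I) = v
      generalize Real.sin (arg u * (1 - t)) = b at hsC ⊢
      generalize Real.sin (arg u * t) = a
      simp only [ofReal_div, ofReal_neg]
      field_simp
      linear_combination -(a : ℂ) * v * hu'
    have hq : q - circularArc p q u t = (q - p) * ((exp ((-(2 * arg u) : ℝ) * I) -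
        exp ((-(2 * arg u) * t : ℝ) * I)) / (exp ((-(2 * arg u) : ℝ) * I) - 1)) := by
      rw [circularArc, if_neg h]
      generalize exp ((-(2 * arg u) : ℝ) * I) = w at hE ⊢
      field_simp
      ring
    rw [hq, circularArc, if_neg h, key]
    ring

end

/-! ### The flype as a sequence of Reidemeister moves -/

namespace Code

theorem labels_append (L L' : Code) : labels (L ++ L') = L.labels ++ L'.labels := by
  simp [labels]

/-- Ensures that forgetting a marked point inside a tangle leaves the rest of the diagram untouched.
-/
theorem map_relabel_update_eq_self {K : Code} {b : ℕ} (a : ℕ) (h : b ∉ K.labels) :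
    K.map (Piece.relabel (Function.update id b a)) = K := by
  rw [List.map_congr_left (g := id), List.map_id]
  intro p hp
  have hne : ∀ x ∈ p.ends, x ≠ b := by
    rintro x hx rfl
    exact h (List.mem_flatMap.2 ⟨p, hp, hx⟩)
  cases p <;> simp_all [Piece.relabel, Piece.ends]

theorem valid_iff_count {L : Code} :
    L.Valid ↔ ∀ x, L.labels.count x = 0 ∨ L.labels.count x = 2 := by
  refine ⟨fun h x => ?_, fun h x hx => (h x).resolve_left (List.count_pos_iff.2 hx).ne'⟩
  by_cases hx : x ∈ L.labels
  · exact Or.inr (h x hx)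
  · exact Or.inl (List.count_eq_zero.2 hx)

theorem Equivalent.symm {L L' : Code} (h : L.Equivalent L') : L'.Equivalent L :=
  Relation.EqvGen.symm _ _ h

theorem Equivalent.trans {L L' L'' : Code} (h : L.Equivalent L') (h' : L'.Equivalent L'') :
    L.Equivalent L'' :=
  Relation.EqvGen.trans _ _ _ h h'

theorem Move.equivalent {L L' : Code} (m : Move L L') (h : L.Valid) (h' : L'.Valid) :
    L.Equivalent L' :=
  Relation.EqvGen.rel _ _ ⟨h, h', m⟩

/-- A tangle with the four outer labels `w, 10, 11, w + 1` and inner labels below `10` is completed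
to a valid code by any code that has the same outer labels, but no inner ones. -/
theorem valid_append {w : ℕ} {K : Code} (hK : ∀ x ∈ K.labels, 10 ≤ x)
    (hc : ∀ x, 10 ≤ x → K.labels.count x + [w, 10, 11, w + 1].count x = 0 ∨
      K.labels.count x + [w, 10, 11, w + 1].count x = 2)
    {H : Code} (h : ∀ x < 10, H.labels.count x = 0 ∨ H.labels.count x = 2)
    (h' : (H.labels.filter (10 ≤ ·)).Perm [w, 10, 11, w + 1]) : Valid (H ++ K) := by
  rw [valid_iff_count]
  intro x
  rw [labels_append, List.count_append]
  rcases lt_or_ge x 10 with hx | hx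
  · have : K.labels.count x = 0 := List.count_eq_zero.2 fun hm => by
      have := hK x hm
      omega
    rw [this]
    exact h x hx
  · have := h'.count_eq x
    rw [List.count_filter (by simpa using hx)] at this
    rw [this, add_comm]
    exact hc x hx

/-- The flype of the crossing `crossing w 10 8 6` over a vertical twist with two crossings. -/
theorem equivalent_flype {w : ℕ} (hw : 12 ≤ w) {K : Code} (hK : ∀ x ∈ K.labels, 10 ≤ x)
    (hc : ∀ x, 10 ≤ x → K.labels.count x + [w, 10, 11, w + 1].count x = 0 ∨
      K.labels.count x + [w, 10, 11, w + 1].count x = 2) :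
    Equivalent
      ([.crossing w 0 8 1, .crossing 0 10 2 8, .crossing 1 2 9 7, .crossing 7 9 11 (w + 1)] ++ K)
      ([.crossing 6 4 5 7, .crossing 4 8 9 5, .crossing w 10 8 6, .crossing 7 9 11 (w + 1)] ++ K)
      := by
  have hmap : ∀ a b, b < 10 → K.map (Piece.relabel (Function.update id b a)) = K := fun a b hb =>
    map_relabel_update_eq_self a fun h => by
      have := hK b h
      omega
  have hw' : ∀ b < 12, w ≠ b := fun b hb => by omega
  have hw'' : ∀ b < 12, w + 1 ≠ b := fun b hb => by omega
  have hwl : 10 ≤ w := by omega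
  have hwl' : 9 ≤ w := by omega
  have V : ∀ H : Code, (∀ x < 10, H.labels.count x = 0 ∨ H.labels.count x = 2) →
      (H.labels.filter (10 ≤ ·)).Perm [w, 10, 11, w + 1] → Valid (H ++ K) :=
    fun H h h' => valid_append hK hc h h'
  -- the codes that are passed through
  let S₀ : Code :=
    [.crossing 6 4 5 7, .crossing 4 8 9 5, .crossing w 10 8 6, .crossing 7 9 11 (w + 1)]
  let S₁ : Code := [.joint 7 3, .crossing 6 4 5 3, .crossing 4 8 9 5, .crossing w 10 8 6,
    .crossing 7 9 11 (w + 1)]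
  let S₂ : Code := [.joint 3 7, .crossing 6 4 5 3, .crossing 4 8 9 5, .crossing w 10 8 6,
    .crossing 7 9 11 (w + 1)]
  let S₃ : Code := [.joint 9 0, .joint 3 7, .crossing 6 4 5 3, .crossing 4 8 0 5,
    .crossing w 10 8 6, .crossing 7 9 11 (w + 1)]
  let S₄ : Code := [.joint 3 7, .joint 9 0, .crossing 6 4 5 3, .crossing 4 8 0 5,
    .crossing w 10 8 6, .crossing 7 9 11 (w + 1)]
  let S₅ : Code := [.crossing 0 2 1 3, .crossing 1 2 9 7, .crossing 6 4 5 3, .crossing 4 8 0 5,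
    .crossing w 10 8 6, .crossing 7 9 11 (w + 1)]
  let S₆ : Code := [.crossing 6 4 5 3, .crossing 4 8 0 5, .crossing 0 2 1 3, .crossing 1 2 9 7,
    .crossing w 10 8 6, .crossing 7 9 11 (w + 1)]
  let S₇ : Code := [.crossing 5 3 6 4, .crossing 4 8 0 5, .crossing 0 2 1 3, .crossing 1 2 9 7,
    .crossing w 10 8 6, .crossing 7 9 11 (w + 1)]
  let S₈ : Code := [.crossing 4 8 0 5, .crossing 5 3 6 4, .crossing 0 2 1 3, .crossing 1 2 9 7,
    .crossing w 10 8 6, .crossing 7 9 11 (w + 1)]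
  let S₉ : Code := [.crossing 0 5 1 6, .crossing 4 3 0 4, .crossing 8 2 5 3, .crossing 1 2 9 7,
    .crossing w 10 8 6, .crossing 7 9 11 (w + 1)]
  let S₁₀ : Code := [.crossing 4 3 0 4, .crossing 0 5 1 6, .crossing 8 2 5 3, .crossing 1 2 9 7,
    .crossing w 10 8 6, .crossing 7 9 11 (w + 1)]
  let S₁₁ : Code := [.crossing 0 4 4 3, .crossing 0 5 1 6, .crossing 8 2 5 3, .crossing 1 2 9 7,
    .crossing w 10 8 6, .crossing 7 9 11 (w + 1)]
  let S₁₂ : Code := [.joint 0 3, .crossing 0 5 1 6, .crossing 8 2 5 3, .crossing 1 2 9 7,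
    .crossing w 10 8 6, .crossing 7 9 11 (w + 1)]
  let S₁₃ : Code := [.crossing 0 5 1 6, .crossing 8 2 5 0, .crossing 1 2 9 7,
    .crossing w 10 8 6, .crossing 7 9 11 (w + 1)]
  let S₁₄ : Code := [.crossing 8 2 5 0, .crossing w 10 8 6, .crossing 0 5 1 6, .crossing 1 2 9 7,
    .crossing 7 9 11 (w + 1)]
  let S₁₅ : Code := [.crossing 5 0 8 2, .crossing w 10 8 6, .crossing 0 5 1 6, .crossing 1 2 9 7,
    .crossing 7 9 11 (w + 1)]
  let S₁₆ : Code := [.crossing w 10 8 6, .crossing 5 0 8 2, .crossing 0 5 1 6, .crossing 1 2 9 7,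
    .crossing 7 9 11 (w + 1)]
  let S₁₇ : Code := [.crossing 8 6 w 10, .crossing 5 0 8 2, .crossing 0 5 1 6, .crossing 1 2 9 7,
    .crossing 7 9 11 (w + 1)]
  let S₁₈ : Code := [.crossing 5 0 8 2, .crossing 8 6 w 10, .crossing 0 5 1 6, .crossing 1 2 9 7,
    .crossing 7 9 11 (w + 1)]
  let S₁₉ : Code := [.crossing 8 1 w 0, .crossing 2 6 0 10, .crossing 5 5 8 6, .crossing 1 2 9 7,
    .crossing 7 9 11 (w + 1)]
  let S₂₀ : Code := [.crossing 5 5 8 6, .crossing 8 1 w 0, .crossing 2 6 0 10, .crossing 1 2 9 7,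
    .crossing 7 9 11 (w + 1)]
  let S₂₁ : Code := [.joint 8 6, .crossing 8 1 w 0, .crossing 2 6 0 10, .crossing 1 2 9 7,
    .crossing 7 9 11 (w + 1)]
  let S₂₂ : Code := [.crossing 8 1 w 0, .crossing 2 8 0 10, .crossing 1 2 9 7,
    .crossing 7 9 11 (w + 1)]
  let S₂₃ : Code := [.crossing w 0 8 1, .crossing 2 8 0 10, .crossing 1 2 9 7,
    .crossing 7 9 11 (w + 1)]
  let S₂₄ : Code := [.crossing 2 8 0 10, .crossing w 0 8 1, .crossing 1 2 9 7,
    .crossing 7 9 11 (w + 1)]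
  let S₂₅ : Code := [.crossing 0 10 2 8, .crossing w 0 8 1, .crossing 1 2 9 7,
    .crossing 7 9 11 (w + 1)]
  let S₂₆ : Code := [.crossing w 0 8 1, .crossing 0 10 2 8, .crossing 1 2 9 7,
    .crossing 7 9 11 (w + 1)]
  have valid : ∀ S ∈ [S₀, S₁, S₂, S₃, S₄, S₅, S₆, S₇, S₈, S₉, S₁₀, S₁₁, S₁₂, S₁₃, S₁₄, S₁₅, S₁₆,
      S₁₇, S₁₈, S₁₉, S₂₀, S₂₁, S₂₂, S₂₃, S₂₄, S₂₅, S₂₆], Valid (S ++ K) := by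
    simp only [List.forall_mem_cons, List.not_mem_nil, false_imp_iff, implies_true, and_true,
      S₀, S₁, S₂, S₃, S₄, S₅, S₆, S₇, S₈, S₉, S₁₀, S₁₁, S₁₂, S₁₃, S₁₄, S₁₅, S₁₆,
      S₁₇, S₁₈, S₁₉, S₂₀, S₂₁, S₂₂, S₂₃, S₂₄, S₂₅, S₂₆]
    refine ⟨?_, ?_, ?_, ?_, ?_, ?_, ?_, ?_, ?_, ?_, ?_, ?_, ?_, ?_, ?_, ?_, ?_, ?_, ?_, ?_, ?_, ?_,
      ?_, ?_, ?_, ?_, ?_⟩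
    all_goals
      refine V _ (fun x hx => ?_) ?_
      · have h1 := hw' x (by omega)
        have h2 := hw'' x (by omega)
        simp only [labels, List.flatMap_cons, List.flatMap_nil, Piece.ends, List.cons_append,
          List.nil_append, List.append_nil, List.count_cons, List.count_nil, beq_iff_eq, h1, h2,
          if_false, add_zero]
        interval_cases x <;> simp
      · simp only [labels, List.flatMap_cons, List.flatMap_nil, Piece.ends, List.cons_append,
          List.nil_append, List.append_nil, List.filter_cons, List.filter_nil]
        simp [hwl, hwl']
        try
          rw [← Multiset.coe_eq_coe]
          simp only [← Multiset.cons_coe, Multiset.coe_nil]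
          simp only [← Multiset.singleton_add]
          abel
  simp only [List.forall_mem_cons, List.not_mem_nil, false_imp_iff, implies_true,
    and_true] at valid
  obtain ⟨v₀, v₁, v₂, v₃, v₄, v₅, v₆, v₇, v₈, v₉, v₁₀, v₁₁, v₁₂, v₁₃, v₁₄, v₁₅, v₁₆, v₁₇, v₁₈, v₁₉,
    v₂₀, v₂₁, v₂₂, v₂₃, v₂₄, v₂₅, v₂₆⟩ := valid
  have rot : ∀ {a b c d : ℕ} {L : Code}, Valid (.crossing a b c d :: L) →
      Valid (.crossing c d a b :: L) →
      Equivalent (.crossing a b c d :: L) (.crossing c d a b :: L) :=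
    fun v v' => (Move.rotateCrossing _ _ _ _ _).equivalent v v'
  have perm : ∀ {H H' : Code}, Valid (H ++ K) → Valid (H' ++ K) → H.Perm H' →
      Equivalent (H ++ K) (H' ++ K) :=
    fun v v' h => (Move.perm (h.append_right K)).equivalent v v'
  have forget : ∀ {a b : ℕ} {H H' : Code}, Valid (.joint a b :: H ++ K) → Valid (H' ++ K) →
      b < 10 → a ≠ b → H.map (Piece.relabel (Function.update id b a)) = H' →
      Equivalent (.joint a b :: H ++ K) (H' ++ K) := fun {a b H H'} v v' hb hab h => by
    refine Move.equivalent ?_ v v'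
    have := Move.forgetJoint a b (H ++ K) hab
    rwa [List.map_append, hmap a b hb, h] at this
  -- Read backwards, `forgetJoint` places marked points on the edges 7 and 9, as the second
  -- Reidemeister move requires.
  have e₁ : Equivalent (S₁ ++ K) (S₀ ++ K) := by
    refine forget v₁ v₀ (by decide) (by decide) ?_
    simp [S₀, Piece.relabel, hw', hw'']
  have e₂ : Equivalent (S₁ ++ K) (S₂ ++ K) := (Move.rotateJoint _ _ _).equivalent v₁ v₂
  have e₃ : Equivalent (S₃ ++ K) (S₂ ++ K) := by
    refine forget v₃ v₂ (by decide) (by decide) ?_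
    simp [S₂, Piece.relabel, hw']
  have e₄ : Equivalent (S₃ ++ K) (S₄ ++ K) := perm v₃ v₄ (.swap _ _ _)
  have e₅ : Equivalent (S₄ ++ K) (S₅ ++ K) := by
    refine Move.equivalent (Move.r2 3 7 0 9 2 1 _ (Or.inl ?_)) v₄ v₅
    -- Both strands end at piece 5, `crossing 7 9 11 (w + 1)`, so its corner between the ends 7 and
    -- 9 links them along one face.
    refine .trans _ (5, 0) _ (.rel _ _ ?_) (.rel _ _ ?_)
    · exact ⟨_, rfl, by simp, 7, rfl, rfl⟩
    · exact ⟨_, rfl, by simp, 9, rfl, rfl⟩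
  have e₆ : Equivalent (S₅ ++ K) (S₆ ++ K) := perm v₅ v₆
    ((List.perm_append_comm (l₁ := [_, _]) (l₂ := [_, _])).append_right [_, _])
  have e₇ : Equivalent (S₆ ++ K) (S₇ ++ K) := rot v₆ v₇
  have e₈ : Equivalent (S₇ ++ K) (S₈ ++ K) := perm v₇ v₈ (.swap _ _ _)
  -- The first triangle move leaves `crossing 4 3 0 4`, whose repeated label 4 is a kink.
  have e₉ : Equivalent (S₈ ++ K) (S₉ ++ K) :=
    (Move.r3 4 4 8 2 1 6 3 0 5 _).equivalent v₈ v₉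
  have e₁₀ : Equivalent (S₉ ++ K) (S₁₀ ++ K) := perm v₉ v₁₀ (.swap _ _ _)
  have e₁₁ : Equivalent (S₁₀ ++ K) (S₁₁ ++ K) := rot v₁₀ v₁₁
  have e₁₂ : Equivalent (S₁₁ ++ K) (S₁₂ ++ K) := (Move.r1' _ _ _ _).equivalent v₁₁ v₁₂
  have e₁₃ : Equivalent (S₁₂ ++ K) (S₁₃ ++ K) := by
    refine forget v₁₂ v₁₃ (by decide) (by decide) ?_
    simp [S₁₃, Piece.relabel, hw', hw'']
  have e₁₄ : Equivalent (S₁₃ ++ K) (S₁₄ ++ K) := perm v₁₃ v₁₄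
    (((List.perm_append_comm (l₁ := [_]) (l₂ := [_, _, _])).append_right [_]).trans
      ((List.perm_append_comm (l₁ := [_]) (l₂ := [_, _])).append_right [_] |>.cons _))
  have e₁₅ : Equivalent (S₁₄ ++ K) (S₁₅ ++ K) := rot v₁₄ v₁₅
  have e₁₆ : Equivalent (S₁₅ ++ K) (S₁₆ ++ K) := perm v₁₅ v₁₆ (.swap _ _ _)
  have e₁₇ : Equivalent (S₁₆ ++ K) (S₁₇ ++ K) := rot v₁₆ v₁₇
  have e₁₈ : Equivalent (S₁₇ ++ K) (S₁₈ ++ K) := perm v₁₇ v₁₈ (.swap _ _ _)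
  -- The second triangle move involves the crossing being flyped and leaves the kink `crossing 5 5 8
  -- 6`.
  have e₁₉ : Equivalent (S₁₈ ++ K) (S₁₉ ++ K) :=
    (Move.r3' 10 2 5 5 1 w 6 0 8 _).equivalent v₁₈ v₁₉
  have e₂₀ : Equivalent (S₁₉ ++ K) (S₂₀ ++ K) := perm v₁₉ v₂₀
    ((List.perm_append_comm (l₁ := [_, _]) (l₂ := [_])).append_right [_, _])
  have e₂₁ : Equivalent (S₂₀ ++ K) (S₂₁ ++ K) := (Move.r1 _ _ _ _).equivalent v₂₀ v₂₁
  have e₂₂ : Equivalent (S₂₁ ++ K) (S₂₂ ++ K) := by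
    refine forget v₂₁ v₂₂ (by decide) (by decide) ?_
    simp [S₂₂, Piece.relabel, hw', hw'']
  have e₂₃ : Equivalent (S₂₂ ++ K) (S₂₃ ++ K) := rot v₂₂ v₂₃
  have e₂₄ : Equivalent (S₂₃ ++ K) (S₂₄ ++ K) := perm v₂₃ v₂₄ (.swap _ _ _)
  have e₂₅ : Equivalent (S₂₄ ++ K) (S₂₅ ++ K) := rot v₂₄ v₂₅
  have e₂₆ : Equivalent (S₂₅ ++ K) (S₂₆ ++ K) := perm v₂₅ v₂₆ (.swap _ _ _)
  have h := e₁.symm.trans <| e₂.trans <| e₃.symm.trans <| e₄.trans <| e₅.trans <| e₆.trans <|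
    e₇.trans <| e₈.trans <| e₉.trans <| e₁₀.trans <| e₁₁.trans <| e₁₂.trans <| e₁₃.trans <|
    e₁₄.trans <| e₁₅.trans <| e₁₆.trans <| e₁₇.trans <| e₁₈.trans <| e₁₉.trans <| e₂₀.trans <|
    e₂₁.trans <| e₂₂.trans <| e₂₃.trans <| e₂₄.trans <| e₂₅.trans e₂₆
  exact h.symm

/-! ### Twists and the flyped family -/

theorem equivalent_relabel {L : Code} (h : L.Valid) {f : ℕ → ℕ} (hf : Function.Injective f) :
    L.Equivalent (L.map (Piece.relabel f)) := by
  refine (Move.relabel L f hf).equivalent h fun x hx => ?_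
  have hl : labels (L.map (Piece.relabel f)) = L.labels.map f := by
    rw [labels, labels, List.flatMap_map, List.map_flatMap]
    congr 1
    funext p
    cases p <;> rfl
  rw [hl] at hx ⊢
  obtain ⟨y, hy, rfl⟩ := List.mem_map.1 hx
  rw [List.count_map_of_injective _ _ hf]
  exact h y hy

/-- A twist with `n` crossings, whose left edges are labelled `a, a + 2, …` and whose right edges
are labelled `a + 1, a + 3, …`. -/
def twist (a n : ℕ) : Code :=
  (List.range n).map fun i =>
    .crossing (a + 2 * i) (a + 2 * (i + 1)) (a + 1 + 2 * (i + 1)) (a + 1 + 2 * i)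

theorem twist_succ (a n : ℕ) : twist a (n + 1) = twist a n ++
    [.crossing (a + 2 * n) (a + 2 * (n + 1)) (a + 1 + 2 * (n + 1)) (a + 1 + 2 * n)] := by
  simp [twist, List.range_succ]

theorem length_twist (a n : ℕ) : (twist a n).length = n := by
  simp [twist]

theorem map_relabel_twist (a b n : ℕ) :
    (twist a n).map (Piece.relabel (· + b)) = twist (a + b) n := by
  simp only [twist, List.map_map]
  refine List.map_congr_left fun i _ => ?_
  simp only [Function.comp, Piece.relabel, Piece.crossing.injEq]
  omega

/-- Adding the four outer labels closes the twist, so that every label in its range occurs twice.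
The form also covers `n = 0`, where the outer labels coincide in pairs. -/
theorem count_labels_twist (a n x : ℕ) :
    (twist a n).labels.count x + [a + 2 * n, a, a + 1, a + 2 * n + 1].count x =
      if a ≤ x ∧ x < a + 2 * n + 2 then 2 else 0 := by
  induction n with
  | zero =>
    simp only [twist, labels, List.range_zero, List.map_nil, List.flatMap_nil, List.count_nil,
      List.count_cons, beq_iff_eq]
    split_ifs <;> omega
  | succ n ih =>
    rw [twist_succ, labels_append, List.count_append]
    have h : List.count x (twist a n).labels + List.count x (labels [.crossing (a + 2 * n)
          (a + 2 * (n + 1)) (a + 1 + 2 * (n + 1)) (a + 1 + 2 * n)]) +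
        List.count x [a + 2 * (n + 1), a, a + 1, a + 2 * (n + 1) + 1] =
        (if a ≤ x ∧ x < a + 2 * n + 2 then 2 else 0) +
          2 * ((if a + 2 * n + 2 = x then 1 else 0) + if a + 2 * n + 3 = x then 1 else 0) := by
      rw [← ih]
      simp only [labels, List.flatMap_cons, List.flatMap_nil, Piece.ends, List.append_nil,
        List.count_cons, List.count_nil, beq_iff_eq, show a + 2 * (n + 1) = a + 2 * n + 2 by ring,
        show a + 1 + 2 * (n + 1) = a + 2 * n + 3 by ring,
        show a + 2 * n + 2 + 1 = a + 2 * n + 3 by ring, show a + 1 + 2 * n = a + 2 * n + 1 by ring]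
      ring
    rw [h]
    split_ifs <;> omega

theorem family_eq (n : ℕ) : family n = [.crossing 2 0 1 3, .crossing 0 4 5 1,
    .crossing (6 + 2 * n) 6 4 2, .crossing 3 5 7 (7 + 2 * n)] ++ twist 6 n :=
  rfl

/-- If the ends of `H` carry each of some labels below `a` twice, and the outer labels of a twist
once, then `H` is completed to a valid code by that twist. -/
theorem valid_append_twist {a n : ℕ} {H : Code} {l : List ℕ} (hl : l.Nodup) (hla : ∀ x ∈ l, x < a)
    (hH : ∀ x, H.labels.count x =
      2 * l.count x + [a + 2 * n, a, a + 1, a + 2 * n + 1].count x) :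
    Valid (H ++ twist a n) := by
  rw [valid_iff_count]
  intro x
  have h := count_labels_twist a n x
  rw [labels_append, List.count_append, hH x]
  have h1 := List.nodup_iff_count_le_one.1 hl x
  have h2 : 0 < l.count x → x < a := fun h => hla x (List.count_pos_iff.1 h)
  split_ifs at h <;> omega

theorem valid_family (n : ℕ) : (family n).Valid := by
  rw [family_eq]
  refine valid_append_twist (l := [0, 1, 2, 3, 4, 5]) (by decide) (by decide) fun x => ?_
  simp only [labels, List.flatMap_cons, List.flatMap_nil, Piece.ends, List.cons_append,
    List.nil_append, List.append_nil, List.count_cons, List.count_nil, beq_iff_eq,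
    show 7 + 2 * n = 6 + 2 * n + 1 by ring]
  ring

/-- The diagram obtained from `family n` by a flype that makes its third and fourth crossing span a
lens. -/
def flypedFamily (n : ℕ) : Code :=
  [.crossing (10 + 2 * n) 0 8 1, .crossing 0 10 2 8, .crossing 1 2 9 7,
    .crossing 7 9 11 (11 + 2 * n)] ++ twist 10 n

theorem length_flypedFamily (n : ℕ) : (flypedFamily n).length = n + 4 := by
  simp [flypedFamily, length_twist]

theorem equivalent_flypedFamily {n : ℕ} (hn : 1 ≤ n) :
    (flypedFamily n).Equivalent (family n) := by
  -- Shifting by 4 turns the lowest twist labels 6 and 7 into 10 and 11, freeing the labels below 10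
  -- for the inside of the flype tangle.
  refine .trans ?_ (equivalent_relabel (valid_family n) (add_left_injective 4)).symm
  have h := equivalent_flype (w := 10 + 2 * n) (K := twist 10 n) (by omega) (fun x hx => ?_)
    (fun x hx => ?_)
  · rw [family_eq, List.map_append, map_relabel_twist]
    rw [show 10 + 2 * n + 1 = 11 + 2 * n by ring] at h
    simp only [List.map_cons, List.map_nil, Piece.relabel, show 6 + 2 * n + 4 = 10 + 2 * n by ring,
      show 7 + 2 * n + 4 = 11 + 2 * n by ring]
    exact h
  · have := count_labels_twist 10 n x
    have := List.count_pos_iff.2 hx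
    split_ifs at * <;> omega
  · rw [count_labels_twist 10 n x]
    split_ifs <;> simp

theorem valid_flypedFamily (n : ℕ) : (flypedFamily n).Valid := by
  refine valid_append_twist (l := [0, 1, 2, 7, 8, 9]) (by decide) (by decide) fun x => ?_
  simp only [labels, List.flatMap_cons, List.flatMap_nil, Piece.ends, List.cons_append,
    List.nil_append, List.append_nil, List.count_cons, List.count_nil, beq_iff_eq,
    show 11 + 2 * n = 10 + 2 * n + 1 by ring]
  ring

/-! ### Incidences and connectivity of the flyped diagram -/

/-- The label of the end number `k` of the piece number `i` of `flypedFamily n`. -/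
def flypedLabel (n : ℕ) : ℕ → ℕ → ℕ
  | 0, 0 => 10 + 2 * n
  | 0, 1 => 0
  | 0, 2 => 8
  | 0, _ => 1
  | 1, 0 => 0
  | 1, 1 => 10
  | 1, 2 => 2
  | 1, _ => 8
  | 2, 0 => 1
  | 2, 1 => 2
  | 2, 2 => 9
  | 2, _ => 7
  | 3, 0 => 7
  | 3, 1 => 9
  | 3, 2 => 11
  | 3, _ => 11 + 2 * n
  | j + 4, 0 => 10 + 2 * j
  | j + 4, 1 => 12 + 2 * j
  | j + 4, 2 => 13 + 2 * j
  | j + 4, _ => 11 + 2 * j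

theorem getElem?_flypedFamily {n i : ℕ} (hi : i < n + 4) :
    (flypedFamily n)[i]? = some (.crossing (flypedLabel n i 0) (flypedLabel n i 1)
      (flypedLabel n i 2) (flypedLabel n i 3)) := by
  rcases i with _ | _ | _ | _ | j
  · rfl
  · rfl
  · rfl
  · rfl
  · have : (flypedFamily n)[j + 4]? = (twist 10 n)[j]? := by
      simp [flypedFamily]
    rw [this, twist, List.getElem?_map, List.getElem?_range (by omega)]
    refine congrArg some ?_
    change Piece.crossing _ _ _ _ =
      Piece.crossing (10 + 2 * j) (12 + 2 * j) (13 + 2 * j) (11 + 2 * j)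
    congr 1 <;> omega

theorem endLabel_flypedFamily {n i k : ℕ} (hi : i < n + 4) (hk : k < 4) :
    (flypedFamily n).endLabel (i, k) = some (flypedLabel n i k) := by
  rw [endLabel, getElem?_flypedFamily hi]
  interval_cases k <;> rfl

theorem flypedLabel_ne {n i k m : ℕ} (hn : 2 ≤ n) (hi : i < n + 4) (hk : k < 4) (hm : m < 4)
    (hkm : k ≠ m) : flypedLabel n i k ≠ flypedLabel n i m := by
  rcases i with _ | _ | _ | _ | j <;> interval_cases k <;> interval_cases m <;>
    simp only [flypedLabel] <;> omega

theorem adj_flypedFamily {n i j k m : ℕ} (hi : i < n + 4) (hj : j < n + 4) (hij : i ≠ j)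
    (hk : k < 4) (hm : m < 4) (h : flypedLabel n i k = flypedLabel n j m) :
    (flypedFamily n).Adj i j :=
  ⟨k, m, fun e => hij (congrArg Prod.fst e), _, endLabel_flypedFamily hi hk,
    h ▸ endLabel_flypedFamily hj hm⟩

/-- Outside any one vertex `v`, the diagram `flypedFamily n` is connected. -/
theorem flypedFamily_joined_avoiding {n : ℕ} (hn : 2 ≤ n) (v : ℕ) {i j : ℕ} (hi : i < n + 4)
    (hj : j < n + 4) (hiv : i ≠ v) (hjv : j ≠ v) :
    Relation.EqvGen (fun x y => x ≠ v ∧ y ≠ v ∧ (flypedFamily n).Adj x y) i j := by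
  have A : ∀ {x y : ℕ} (k m : ℕ), x ≠ v → y ≠ v → x < n + 4 → y < n + 4 → x ≠ y → k < 4 → m < 4 →
      flypedLabel n x k = flypedLabel n y m →
      Relation.EqvGen (fun x y => x ≠ v ∧ y ≠ v ∧ (flypedFamily n).Adj x y) x y :=
    fun k m hx hy hx' hy' hxy hk hm h =>
      .rel _ _ ⟨hx, hy, adj_flypedFamily hx' hy' hxy hk hm h⟩
  have down : ∀ x, x < n → (∀ y ≤ x, y + 4 ≠ v) →
      Relation.EqvGen (fun x y => x ≠ v ∧ y ≠ v ∧ (flypedFamily n).Adj x y) (x + 4) 4 := by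
    intro x
    induction x with
    | zero => exact fun _ _ => .refl _
    | succ x ih =>
      intro hx hy
      refine .trans _ (x + 4) _ ?_ (ih (by omega) fun y hy' => hy y (by omega))
      refine A 0 1 (hy _ le_rfl) (hy _ (by omega)) (by omega) (by omega) (by omega) (by omega)
        (by omega) ?_
      simp only [flypedLabel]
      omega
  have up : ∀ d x, x + 1 + d = n → (∀ y, x ≤ y → y < n → y + 4 ≠ v) →
      Relation.EqvGen (fun x y => x ≠ v ∧ y ≠ v ∧ (flypedFamily n).Adj x y) (x + 4) (n + 3) := by
    intro d
    induction d with
    | zero =>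
      rintro x rfl -
      exact .refl _
    | succ d ih =>
      intro x hx hy
      refine .trans _ (x + 1 + 4) _ ?_
        (ih (x + 1) (by omega) fun y h1 h2 => hy y (by omega) h2)
      refine A 1 0 (hy _ le_rfl (by omega)) (hy _ (by omega) (by omega)) (by omega) (by omega)
        (by omega) (by omega) (by omega) ?_
      simp only [flypedLabel]
      omega
  have e01 : 0 ≠ v → 1 ≠ v → _ := fun h h' =>
    A (x := 0) (y := 1) 1 0 h h' (by omega) (by omega) (by omega) (by omega) (by omega) rfl
  have e02 : 0 ≠ v → 2 ≠ v → _ := fun h h' =>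
    A (x := 0) (y := 2) 3 0 h h' (by omega) (by omega) (by omega) (by omega) (by omega) rfl
  have e12 : 1 ≠ v → 2 ≠ v → _ := fun h h' =>
    A (x := 1) (y := 2) 2 1 h h' (by omega) (by omega) (by omega) (by omega) (by omega) rfl
  have e23 : 2 ≠ v → 3 ≠ v → _ := fun h h' =>
    A (x := 2) (y := 3) 3 0 h h' (by omega) (by omega) (by omega) (by omega) (by omega) rfl
  have e14 : 1 ≠ v → 4 ≠ v → _ := fun h h' =>
    A (x := 1) (y := 4) 1 0 h h' (by omega) (by omega) (by omega) (by omega) (by omega) rfl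
  have e34 : 3 ≠ v → 4 ≠ v → _ := fun h h' =>
    A (x := 3) (y := 4) 2 3 h h' (by omega) (by omega) (by omega) (by omega) (by omega) rfl
  have e3n : 3 ≠ v → n + 3 ≠ v → _ := fun h h' =>
    A (x := 3) (y := n + 3) 3 2 h h' (by omega) (by omega) (by omega) (by omega) (by omega) (by
      obtain ⟨m, rfl⟩ : ∃ m, n = m + 1 := ⟨n - 1, by omega⟩
      simp only [flypedLabel]
      omega)
  -- All vertices are linked to one root: vertex 3, or vertex 1 if 3 is removed. The twist is a path
  -- attached to 3 at both ends, so when one of its vertices is removed the others still reach 3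
  -- downwards or upwards.
  suffices h : ∃ r, ∀ x < n + 4, x ≠ v →
      Relation.EqvGen (fun x y => x ≠ v ∧ y ≠ v ∧ (flypedFamily n).Adj x y) x r by
    obtain ⟨r, h⟩ := h
    exact .trans _ _ _ (h i hi hiv) (.symm _ _ (h j hj hjv))
  by_cases h3 : v = 3
  · have e41 := (e14 (by omega) (by omega)).symm
    refine ⟨1, fun x hx hxv => ?_⟩
    rcases x with _ | _ | _ | _ | x
    · exact e01 (by omega) (by omega)
    · exact .refl _
    · exact (e12 (by omega) (by omega)).symm
    · omega
    · exact .trans _ _ _ (down x (by omega) fun y _ => by omega) e41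
  · refine ⟨3, fun x hx hxv => ?_⟩
    by_cases h2 : v = 2
    · have e43 := (e34 (by omega) (by omega)).symm
      have e13 := Relation.EqvGen.trans _ _ _ (e14 (by omega) (by omega)) e43
      rcases x with _ | _ | _ | _ | x
      · exact .trans _ _ _ (e01 (by omega) (by omega)) e13
      · exact e13
      · omega
      · exact .refl _
      · exact .trans _ _ _ (down x (by omega) fun y _ => by omega) e43
    · have e23' := e23 (by omega) (by omega)
      rcases x with _ | _ | _ | _ | x
      · exact .trans _ _ _ (e02 (by omega) (by omega)) e23'
      · exact .trans _ _ _ (e12 (by omega) (by omega)) e23'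
      · exact e23'
      · exact .refl _
      · by_cases hxv' : x + 4 < v
        · exact .trans _ _ _ (down x (by omega) fun y _ => by omega)
            (e34 (by omega) (by omega)).symm
        · by_cases hv : v < 4
          · exact .trans _ _ _ (down x (by omega) fun y _ => by omega)
              (e34 (by omega) (by omega)).symm
          · exact .trans _ _ _ (up (n - (x + 1)) x (by omega) fun y _ _ => by omega)
              (e3n (by omega) (by omega)).symm

theorem isLinkMultigraph_flypedFamily {n : ℕ} (hn : 2 ≤ n) :
    (flypedFamily n).IsLinkMultigraph where
  valid := valid_flypedFamily n
  fourRegular p hp := by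
    obtain ⟨i, hi⟩ := List.mem_iff_getElem?.1 hp
    have hlt := (List.getElem?_eq_some_iff.1 hi).1
    rw [length_flypedFamily] at hlt
    rw [getElem?_flypedFamily hlt, Option.some.injEq] at hi
    rw [← hi]
    trivial
  loopless p hp := by
    obtain ⟨i, hi⟩ := List.mem_iff_getElem?.1 hp
    have hlt := (List.getElem?_eq_some_iff.1 hi).1
    rw [length_flypedFamily] at hlt
    rw [getElem?_flypedFamily hlt, Option.some.injEq] at hi
    have h : ∀ k m, k < 4 → m < 4 → k ≠ m → flypedLabel n i k ≠ flypedLabel n i m :=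
      fun k m => flypedLabel_ne hn hlt
    rw [← hi]
    simp [Piece.ends, h]
  connected i j hi hj := by
    rw [length_flypedFamily] at hi hj
    -- There is no vertex number `n + 4`, so avoiding it removes nothing.
    exact (flypedFamily_joined_avoiding hn (n + 4) hi hj hi.ne hj.ne).mono fun _ _ h => h.2.2
  no_cut_vertex v i j _ hi hj hiv hjv := by
    rw [length_flypedFamily] at hi hj
    exact flypedFamily_joined_avoiding hn v hi hj hiv hjv

end Code

/-! ### Lombardi drawings from edge data -/

/-- The interior of the circular arc `circularArc p q u`. -/
def arcInterior (p q u : ℂ) : Set ℂ := {z | ∃ s : ℝ, 0 < s ∧ z - p = s * u * (q - z)}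

/-- A plane Lombardi drawing is given by the two end points `P x`, `Q x` and the direction `U x` of
the edge labelled `x`, for each label `x`. -/
theorem PlaneLombardiDrawing.nonempty_of_edges {L : Code} {lab : Fin L.length → Fin 4 → ℕ}
    {pos : Fin L.length → ℂ} {P Q U : ℕ → ℂ}
    (hlab : ∀ (i : Fin L.length) (k : Fin 4), L.endLabel ((i : ℕ), (k : ℕ)) = some (lab i k))
    (hloop : ∀ i k m, k ≠ m → lab i k ≠ lab i m)
    (hpos : Function.Injective pos)
    (hU : ∀ i k, U (lab i k) ∈ Complex.slitPlane)
    (hPQ : ∀ i k, P (lab i k) ≠ Q (lab i k))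
    (hangle : ∀ i : Fin L.length, ∃ u : ℂ, u ≠ 0 ∧ ∀ k : Fin 4, ∃ s : ℝ, 0 < s ∧
      (pos i = P (lab i k) ∧
          (Q (lab i k) - P (lab i k)) * U (lab i k) = s * (u * Complex.I ^ (k : ℕ)) ∨
        pos i = Q (lab i k) ∧
          (P (lab i k) - Q (lab i k)) * (U (lab i k))⁻¹ = s * (u * Complex.I ^ (k : ℕ))))
    (hend : ∀ (i j : Fin L.length) (k m : Fin 4), ∀ z ∈ arcInterior (P (lab i k)) (Q (lab i k)) (U (lab i k)),
      z ≠ P (lab j m) ∧ z ≠ Q (lab j m))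
    (hdisj : ∀ (i j : Fin L.length) (k m : Fin 4), lab i k ≠ lab j m →
      ∀ z ∈ arcInterior (P (lab i k)) (Q (lab i k)) (U (lab i k)),
        z ∉ arcInterior (P (lab j m)) (Q (lab j m)) (U (lab j m))) :
    Nonempty (PlaneLombardiDrawing L) := by
  classical
  let A (x : ℕ) : ℝ → ℂ := circularArc (P x) (Q x) (U x)
  let B (x : ℕ) : ℝ → ℂ := circularArc (Q x) (P x) (U x)⁻¹
  have hB : ∀ i k t, B (lab i k) t = A (lab i k) (1 - t) := fun i k t =>
    circularArc_reverse (hU i k) t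
  have hU' : ∀ i k, (U (lab i k))⁻¹ ∈ Complex.slitPlane := fun i k => by
    have h := Complex.mem_slitPlane_iff_arg.1 (hU i k)
    rw [Complex.mem_slitPlane_iff_arg, Complex.arg_inv, if_neg h.1]
    exact ⟨fun h' => by linarith [Complex.neg_pi_lt_arg (U (lab i k))], inv_ne_zero h.2⟩
  -- Each edge has one stored orientation; an end located at its target uses the reversed arc.
  let arc (i : Fin L.length) (k : Fin 4) : ℝ → ℂ :=
    if pos i = P (lab i k) then A (lab i k) else B (lab i k)
  have hor : ∀ i k, pos i = P (lab i k) ∨ pos i = Q (lab i k) := fun i k => by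
    obtain ⟨u, -, h⟩ := hangle i
    obtain ⟨s, -, h⟩ := h k
    exact h.imp And.left And.left
  have harcP : ∀ {i k}, pos i = P (lab i k) → arc i k = A (lab i k) := fun h => if_pos h
  have harcQ : ∀ {i k}, pos i = Q (lab i k) → arc i k = B (lab i k) := fun {i k} h =>
    if_neg fun h' => hPQ i k (h'.symm.trans h)
  have hzero : ∀ i k, arc i k 0 = pos i := fun i k => by
    rcases hor i k with h | h
    · rw [harcP h, h]; exact circularArc_zero
    · rw [harcQ h, h]; exact circularArc_zero
  have hone : ∀ i k, arc i k 1 = P (lab i k) ∨ arc i k 1 = Q (lab i k) := fun i k => by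
    rcases hor i k with h | h
    · rw [harcP h]; exact Or.inr (circularArc_one (hU i k))
    · rw [harcQ h]; exact Or.inl (circularArc_one (hU' i k))
  have hint : ∀ i k, ∀ t ∈ Set.Ioo (0 : ℝ) 1,
      arc i k t ∈ arcInterior (P (lab i k)) (Q (lab i k)) (U (lab i k)) := fun i k t ht => by
    rcases hor i k with h | h
    · rw [harcP h]; exact exists_circularArc_sub_eq (hU i k) ht
    · rw [harcQ h, hB]
      exact exists_circularArc_sub_eq (hU i k) ⟨by linarith [ht.2], by linarith [ht.1]⟩
  have hvert : ∀ i k j, ∀ t ∈ Set.Ioo (0 : ℝ) 1, arc i k t ≠ pos j := fun i k j t ht => by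
    rcases hor j 0 with h | h
    · rw [h]; exact (hend i j k 0 _ (hint i k t ht)).1
    · rw [h]; exact (hend i j k 0 _ (hint i k t ht)).2
  have hdisj' : ∀ (i j : Fin L.length) (k m : Fin 4), lab i k ≠ lab j m → ∀ s ∈ Set.Ioo (0 : ℝ) 1, ∀ t ∈ Set.Icc (0 : ℝ) 1,
      arc i k s ≠ arc j m t := fun i j k m hne s hs t ht heq => by
    rcases eq_or_lt_of_le ht.1 with rfl | h0
    · exact hvert i k j s hs (heq.trans (hzero j m))
    rcases eq_or_lt_of_le ht.2 with rfl | h1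
    · have := hend i j k m _ (hint i k s hs)
      rcases hone j m with h | h
      · exact this.1 (heq.trans h)
      · exact this.2 (heq.trans h)
    · exact hdisj i j k m hne _ (hint i k s hs) (heq ▸ hint j m t ⟨h0, h1⟩)
  refine ⟨⟨pos, arc, hpos, fun i k => ?_, hzero, fun i j k m hmates t => ?_, hvert, fun i => ?_,
    fun i j k m hne s hs t ht heq => ?_⟩⟩
  · rcases hor i k with h | h
    · rw [harcP h]; exact isCircularArc_circularArc (hU i k) (hPQ i k)
    · rw [harcQ h]; exact isCircularArc_circularArc (hU' i k) (hPQ i k).symm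
  · obtain ⟨hne, x, h1, h2⟩ := hmates
    rw [hlab, Option.some.injEq] at h1 h2
    have hl : lab j m = lab i k := h2.trans h1.symm
    have hij : i ≠ j := by
      rintro rfl
      exact hloop i k m (by rintro rfl; exact hne rfl) hl.symm
    have hp : pos i ≠ pos j := fun h => hij (hpos h)
    rcases hor i k with h | h <;> rcases hor j m with h' | h'
    · rw [hl] at h'; exact absurd (h.trans h'.symm) hp
    · rw [harcP h, harcQ h', hl, hB]
    · rw [harcQ h, harcP h', hl, hB]; congr 1; ring
    · rw [hl] at h'; exact absurd (h.trans h'.symm) hp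
  · obtain ⟨u, hu, h⟩ := hangle i
    refine ⟨u, hu, fun k => ?_⟩
    obtain ⟨s, hs, ⟨h, h'⟩ | ⟨h, h'⟩⟩ := h k
    · obtain ⟨r, hr, hd⟩ := exists_hasDerivAt_circularArc (p := P (lab i k)) (q := Q (lab i k))
        (hU i k)
      refine ⟨r * s, mul_pos hr hs, ?_⟩
      rw [harcP h]
      refine hd.congr_deriv ?_
      rw [h']; push_cast; ring
    · obtain ⟨r, hr, hd⟩ := exists_hasDerivAt_circularArc (p := Q (lab i k)) (q := P (lab i k))
        (hU' i k)
      refine ⟨r * s, mul_pos hr hs, ?_⟩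
      rw [harcQ h]
      refine hd.congr_deriv ?_
      rw [h']; push_cast; ring
  · have hne' : lab i k ≠ lab j m := fun h => hne (by rw [hlab, hlab, h])
    constructor
    · by_contra! h
      exact hdisj' i j k m hne' s ⟨lt_of_le_of_ne hs.1 h.1.symm, lt_of_le_of_ne hs.2 h.2⟩ t ht heq
    · by_contra! h
      exact hdisj' j i m k hne'.symm t ⟨lt_of_le_of_ne ht.1 h.1.symm, lt_of_le_of_ne ht.2 h.2⟩ s hs
        heq.symm

/-! ### Inversion of arcs and rays -/

/-- An edge of the preimage of a drawing under the inversion `z ↦ (z - (1 - I))⁻¹`: a circular arc,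
or a ray, whose end at infinity is drawn at `0`. -/
inductive ModelEdge : Type
  | arc (p q u : ℂ) : ModelEdge
  | ray (p d : ℂ) : ModelEdge

namespace ModelEdge

/-- The points in the interior of the edge. -/
def interior : ModelEdge → Set ℂ
  | .arc p q u => arcInterior p q u
  | .ray p d => {z | ∃ s : ℝ, 0 < s ∧ z - p = s * d}

/-- The edge is an arc or a ray whose end points can be inverted. -/
def Proper : ModelEdge → Prop
  | .arc p q u => p ≠ 1 - I ∧ q ≠ 1 - I ∧ p ≠ q ∧ u ∈ slitPlane
  | .ray p d => p ≠ 1 - I ∧ d ≠ 0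

/-- The edge leaves its finite end point `z` in the direction of `v`. -/
def Leaves (z v : ℂ) : ModelEdge → Prop
  | .arc p q u => ∃ s : ℝ, 0 < s ∧ (z = p ∧ (q - p) * u = s * v ∨ z = q ∧ (p - q) * u⁻¹ = s * v)
  | .ray p d => ∃ s : ℝ, 0 < s ∧ z = p ∧ d = s * v

/-- The start of the inverted edge. -/
noncomputable def source : ModelEdge → ℂ
  | .arc p _ _ => (p - (1 - I))⁻¹
  | .ray p _ => (p - (1 - I))⁻¹

/-- The end of the inverted edge. -/
noncomputable def target : ModelEdge → ℂ
  | .arc _ q _ => (q - (1 - I))⁻¹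
  | .ray _ _ => 0

/-- The inverted edge is `circularArc E.source E.target E.direction`. -/
noncomputable def direction : ModelEdge → ℂ
  | .arc p q u => u * (q - (1 - I)) / (p - (1 - I))
  | .ray p d => d / (p - (1 - I))

theorem source_ne_target {E : ModelEdge} (h : E.Proper) : E.source ≠ E.target := by
  rcases E with ⟨p, q, u⟩ | ⟨p, d⟩
  · exact fun e => h.2.2.1 (sub_left_injective (inv_injective e))
  · exact inv_ne_zero (sub_ne_zero.2 h.1)

/-- With pole `c = 1 - I`, inversion multiplies `(z - p) / (q - z)` by `(q - c) / (p - c)`, which is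
built into `direction`; for a ray, `(z - p) / (p - c)` takes its place. On an arc, `w = 0` would
correspond to `z = ∞` and force `u` to be a negative real. -/
theorem ne_zero_and_mem_interior {E : ModelEdge} (h : E.Proper) {w : ℂ}
    (hw : w ∈ arcInterior E.source E.target E.direction) :
    w ≠ 0 ∧ w⁻¹ + (1 - I) ∈ E.interior := by
  rcases E with ⟨p, q, u⟩ | ⟨p, d⟩
  · obtain ⟨hp, hq, -, hu⟩ := h
    obtain ⟨s, hs, e⟩ := hw
    simp only [source, target, direction] at e
    have hp' := sub_ne_zero.2 hp
    have hq' := sub_ne_zero.2 hq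
    have key : w * (p - (1 - I)) - 1 = s * u * (1 - w * (q - (1 - I))) := by
      generalize p - (1 - I) = a at *
      generalize q - (1 - I) = b at *
      field_simp at e
      exact e
    have hw0 : w ≠ 0 := by
      rintro rfl
      have h1 : u = ((-s⁻¹ : ℝ) : ℂ) := by
        have : (s : ℂ) ≠ 0 := by exact_mod_cast hs.ne'
        push_cast
        field_simp
        linear_combination -key
      rw [h1, mem_slitPlane_iff, ofReal_re, ofReal_im] at hu
      have := inv_pos.2 hs
      rcases hu with hu | hu
      · linarith
      · exact hu rfl
    refine ⟨hw0, s, hs, ?_⟩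
    field_simp
    linear_combination -key
  · obtain ⟨hp, -⟩ := h
    obtain ⟨s, hs, e⟩ := hw
    simp only [source, target, direction] at e
    have hp' := sub_ne_zero.2 hp
    have key : w * (p - (1 - I)) - 1 = s * d * (-w) := by
      generalize p - (1 - I) = a at *
      field_simp at e
      linear_combination e
    have hw0 : w ≠ 0 := by
      rintro rfl
      simp at key
    refine ⟨hw0, s, hs, ?_⟩
    field_simp
    linear_combination -key

/-- A direction `-r` with `r > 0` would mean that the inverted edge passes through infinity, that
is, that the pole lies on the original edge, at parameter `r⁻¹`. -/
theorem direction_mem_slitPlane {E : ModelEdge} (h : E.Proper) (h' : 1 - I ∉ E.interior) :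
    E.direction ∈ slitPlane := by
  have key : ∀ z : ℂ, z ≠ 0 → z ∉ slitPlane → ∃ r : ℝ, 0 < r ∧ z = -(r : ℂ) := by
    intro z hz hz'
    rw [mem_slitPlane_iff] at hz'
    push Not at hz'
    obtain ⟨hre, him⟩ := hz'
    have hre' : z.re ≠ 0 := fun h0 => hz (Complex.ext h0 him)
    exact ⟨-z.re, by have := lt_of_le_of_ne hre hre'; linarith, Complex.ext (by simp) (by simp [him])⟩
  by_contra hd
  apply h'
  rcases E with ⟨p, q, u⟩ | ⟨p, d⟩
  · obtain ⟨hp, hq, -, hu⟩ := h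
    have hp' := sub_ne_zero.2 hp
    have hq' := sub_ne_zero.2 hq
    obtain ⟨r, hr, e⟩ := key _ (div_ne_zero (mul_ne_zero (slitPlane_ne_zero hu) hq') hp') hd
    rw [div_eq_iff hp'] at e
    refine ⟨r⁻¹, inv_pos.2 hr, ?_⟩
    have : (r : ℂ) ≠ 0 := by exact_mod_cast hr.ne'
    push_cast
    field_simp
    linear_combination -e
  · obtain ⟨hp, hd0⟩ := h
    have hp' := sub_ne_zero.2 hp
    obtain ⟨r, hr, e⟩ := key _ (div_ne_zero hd0 hp') hd
    rw [div_eq_iff hp'] at e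
    refine ⟨r⁻¹, inv_pos.2 hr, ?_⟩
    have : (r : ℂ) ≠ 0 := by exact_mod_cast hr.ne'
    push_cast
    field_simp
    linear_combination -e

/-- Inversion is conformal: the factor `-1 / (z - (1 - I)) ^ 2` is its derivative at `z`, the same
for all edges at `z`. -/
theorem Leaves.inverted {E : ModelEdge} (h : E.Proper) {z v : ℂ} (hl : E.Leaves z v) :
    ∃ s : ℝ, 0 < s ∧
      ((z - (1 - I))⁻¹ = E.source ∧
          (E.target - E.source) * E.direction = s * (-v / (z - (1 - I)) ^ 2) ∨
        (z - (1 - I))⁻¹ = E.target ∧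
          (E.source - E.target) * E.direction⁻¹ = s * (-v / (z - (1 - I)) ^ 2)) := by
  rcases E with ⟨p, q, u⟩ | ⟨p, d⟩
  · obtain ⟨hp, hq, -, hu⟩ := h
    have hp' := sub_ne_zero.2 hp
    have hq' := sub_ne_zero.2 hq
    have hu' := slitPlane_ne_zero hu
    obtain ⟨s, hs, ⟨rfl, e⟩ | ⟨rfl, e⟩⟩ := hl
    · refine ⟨s, hs, Or.inl ⟨rfl, ?_⟩⟩
      have e' : (q - (1 - I) - (z - (1 - I))) * u = s * v := by rw [← e]; ring
      simp only [source, target, direction]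
      generalize z - (1 - I) = a at *
      generalize q - (1 - I) = b at *
      field_simp
      linear_combination -e'
    · refine ⟨s, hs, Or.inr ⟨rfl, ?_⟩⟩
      have e' : (p - (1 - I) - (z - (1 - I))) * u⁻¹ = s * v := by rw [← e]; ring
      simp only [source, target, direction]
      generalize z - (1 - I) = a at *
      generalize p - (1 - I) = b at *
      field_simp at e' ⊢
      linear_combination -e'
  · obtain ⟨hp, hd⟩ := h
    have hp' := sub_ne_zero.2 hp
    obtain ⟨s, hs, rfl, e⟩ := hl
    refine ⟨s, hs, Or.inl ⟨rfl, ?_⟩⟩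
    simp only [source, target, direction]
    generalize z - (1 - I) = a at *
    field_simp
    linear_combination -e

end ModelEdge

/-! ### The model drawing and its planarity -/

/-- Equally spaced points on the segment from `-8` to `8 * I`. -/
noncomputable def twistPoint (n j : ℕ) : ℂ := ⟨-8 + 8 / (n - 1) * j, 8 / (n - 1) * j⟩

/-- The edge labelled `x` in the preimage of the drawing of `flypedFamily n`. -/
noncomputable def modelEdge (n x : ℕ) : ModelEdge :=
  if x = 0 then .arc I (-1) (-1 - I)
  else if x = 8 then .arc I (-1) (1 - I)
  else if x = 1 then .arc I 0 1
  else if x = 2 then .arc (-1) 0 1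
  else if x = 7 then .ray 0 1
  else if x = 9 then .ray 0 (-I)
  else if x = 10 then .arc (-1) (-8) I
  else if x = 11 then .ray (-8) (-1)
  else if x = 10 + 2 * n then .arc I (8 * I) (-I)
  else if x = 11 + 2 * n then .ray (8 * I) I
  else if x % 2 = 0 then .arc (twistPoint n (x / 2 - 6)) (twistPoint n (x / 2 - 6 + 1)) (1 - I)
  else .arc (twistPoint n (x / 2 - 6)) (twistPoint n (x / 2 - 6 + 1)) (1 + I)

/-- The graph of `modelEdge` on the labels that occur, in a form that allows case analysis without
nested conditionals. -/
inductive IsModelEdge (n : ℕ) : ℕ → ModelEdge → Prop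
  | outerLens : IsModelEdge n 0 (.arc I (-1) (-1 - I))
  | innerLens : IsModelEdge n 8 (.arc I (-1) (1 - I))
  | vertical : IsModelEdge n 1 (.arc I 0 1)
  | horizontal : IsModelEdge n 2 (.arc (-1) 0 1)
  | rayRight : IsModelEdge n 7 (.ray 0 1)
  | rayDown : IsModelEdge n 9 (.ray 0 (-I))
  | lowerArc : IsModelEdge n 10 (.arc (-1) (-8) I)
  | rayLeft : IsModelEdge n 11 (.ray (-8) (-1))
  | upperArc : IsModelEdge n (10 + 2 * n) (.arc I (8 * I) (-I))
  | rayUp : IsModelEdge n (11 + 2 * n) (.ray (8 * I) I)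
  | twistInner (j : ℕ) : j + 1 < n →
      IsModelEdge n (12 + 2 * j) (.arc (twistPoint n j) (twistPoint n (j + 1)) (1 - I))
  | twistOuter (j : ℕ) : j + 1 < n →
      IsModelEdge n (13 + 2 * j) (.arc (twistPoint n j) (twistPoint n (j + 1)) (1 + I))

theorem IsModelEdge.modelEdge_eq {n x : ℕ} {E : ModelEdge} (hn : 2 ≤ n) (h : IsModelEdge n x E) :
    modelEdge n x = E := by
  cases h with
  | twistInner j hj =>
    rw [modelEdge]
    repeat rw [if_neg (by omega)]
    rw [if_pos (by omega), show (12 + 2 * j) / 2 - 6 = j by omega]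
  | twistOuter j hj =>
    rw [modelEdge]
    repeat rw [if_neg (by omega)]
    rw [show (13 + 2 * j) / 2 - 6 = j by omega]
  | upperArc =>
    rw [modelEdge]
    iterate 8 rw [if_neg (by omega)]
    rw [if_pos rfl]
  | rayUp =>
    rw [modelEdge]
    iterate 9 rw [if_neg (by omega)]
    rw [if_pos rfl]
  | _ => simp [modelEdge]

/-- The vertices in the preimage of the drawing, apart from the one at infinity. -/
inductive IsModelVertex (n : ℕ) : ℂ → Prop
  | a : IsModelVertex n I
  | b : IsModelVertex n (-1)
  | c : IsModelVertex n 0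
  | e (j : ℕ) : j < n → IsModelVertex n (twistPoint n j)

/-- A region that contains the edge labelled `x`. -/
inductive IsZone (n : ℕ) : ℕ → ℝ → ℝ → Prop
  | outerLens {x y : ℝ} : x < 0 → 0 < y → 1 < x ^ 2 + y ^ 2 → y - x < 4 → IsZone n 0 x y
  | innerLens {x y : ℝ} : x < 0 → 0 < y → x ^ 2 + y ^ 2 = 1 → y - x < 4 → IsZone n 8 x y
  | vertical {x y : ℝ} : x = 0 → 0 < y → y < 1 → IsZone n 1 x y
  | horizontal {x y : ℝ} : y = 0 → x < 0 → -1 < x → IsZone n 2 x y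
  | rayRight {x y : ℝ} : y = 0 → 0 < x → IsZone n 7 x y
  | rayDown {x y : ℝ} : x = 0 → y < 0 → IsZone n 9 x y
  | lowerArc {x y : ℝ} : x < 0 → y < 0 → IsZone n 10 x y
  | rayLeft {x y : ℝ} : y = 0 → x < -8 → IsZone n 11 x y
  | upperArc {x y : ℝ} : 0 < x → 0 < y → IsZone n (10 + 2 * n) x y
  | rayUp {x y : ℝ} : x = 0 → 8 < y → IsZone n (11 + 2 * n) x y
  | twistInner (j : ℕ) {x y : ℝ} : x < 0 → 0 < y → 4 < y - x → y - x < 8 →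
      8 / (n - 1) * j < x + 8 → x + 8 < 8 / (n - 1) * (j + 1) → IsZone n (12 + 2 * j) x y
  | twistOuter (j : ℕ) {x y : ℝ} : x < 0 → 0 < y → 8 < y - x →
      8 / (n - 1) * j < x + 8 → x + 8 < 8 / (n - 1) * (j + 1) → IsZone n (13 + 2 * j) x y

section

variable {n : ℕ}

theorem twist_step_pos (hn : 2 ≤ n) : (0 : ℝ) < 8 / (n - 1) := by
  have : (2 : ℝ) ≤ n := by exact_mod_cast hn
  exact div_pos (by norm_num) (by linarith)

theorem twist_step_mul (hn : 2 ≤ n) : (8 : ℝ) / (n - 1) * (n - 1) = 8 := by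
  have : (2 : ℝ) ≤ n := by exact_mod_cast hn
  exact div_mul_cancel₀ _ (by linarith)

theorem twist_step_mul_le (hn : 2 ≤ n) {j : ℕ} (hj : j + 1 ≤ n) :
    (8 : ℝ) / (n - 1) * j ≤ 8 := by
  have : (j : ℝ) + 1 ≤ n := by exact_mod_cast hj
  nlinarith [twist_step_pos hn, twist_step_mul hn]

theorem eq_of_twist_step {t : ℝ} (hn : 2 ≤ n) {i j : ℕ} (h1 : 8 / (n - 1) * i < t)
    (h2 : t < 8 / (n - 1) * (i + 1)) (h3 : 8 / (n - 1) * j < t)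
    (h4 : t < 8 / (n - 1) * (j + 1)) : i = j := by
  have hs := twist_step_pos hn
  have h5 : (i : ℝ) < j + 1 := lt_of_mul_lt_mul_left (h1.trans h4) hs.le
  have h6 : (j : ℝ) < i + 1 := lt_of_mul_lt_mul_left (h3.trans h2) hs.le
  have h5' : i < j + 1 := by exact_mod_cast h5
  have h6' : j < i + 1 := by exact_mod_cast h6
  omega

/-- Quadrants and half-axes separate most zones. The second quadrant is cut by the unit circle and
the lines `y - x = 4` and `y - x = 8`, and the twist by vertical strips as well. -/
theorem IsZone.unique (hn : 2 ≤ n) {a b : ℕ} {x y : ℝ} (h : IsZone n a x y) (h' : IsZone n b x y) :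
    a = b := by
  cases h <;> cases h' <;> first
    | rfl
    | (exfalso; linarith)
    | (rw [add_right_inj, mul_right_inj' two_ne_zero]
       apply eq_of_twist_step (t := x + 8) hn <;> assumption)

theorem IsModelVertex.not_isZone (hn : 2 ≤ n) {a : ℕ} {z : ℂ} (h : IsModelVertex n z) :
    ¬ IsZone n a z.re z.im := by
  intro h'
  cases h with
  | a => cases h' <;> (simp at *; try linarith)
  | b => cases h' <;> (simp at *; try linarith)
  | c => cases h' <;> simp at * <;> linarith
  | e j hj =>
    have h1 := twist_step_mul_le hn hj
    have h2 : (0 : ℝ) ≤ 8 / (n - 1) * j := mul_nonneg (twist_step_pos hn).le (Nat.cast_nonneg j)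
    simp only [twistPoint] at h'
    generalize hr : (8 : ℝ) / (n - 1) * j = r at *
    cases h' <;> nlinarith

theorem not_isZone_pole {a : ℕ} : ¬ IsZone n a (1 - I).re (1 - I).im := by
  intro h
  cases h <;> simp at * <;> linarith

theorem IsModelVertex.ne_pole (hn : 2 ≤ n) {z : ℂ} (h : IsModelVertex n z) : z ≠ 1 - I := by
  intro e
  cases h with
  | e j hj =>
    have h2 : (0 : ℝ) ≤ 8 / (n - 1) * j := mul_nonneg (twist_step_pos hn).le (Nat.cast_nonneg j)
    have := congrArg Complex.im e
    simp [twistPoint] at this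
    linarith
  | _ => simp [Complex.ext_iff] at e

theorem twistPoint_zero : twistPoint n 0 = -8 := by
  simp [twistPoint, Complex.ext_iff]

theorem twistPoint_last (hn : 2 ≤ n) {j : ℕ} (hj : j + 1 = n) : twistPoint n j = 8 * I := by
  have := twist_step_mul hn
  have e : (j : ℝ) = n - 1 := by rw [← hj]; push_cast; ring
  rw [twistPoint, e, this]
  simp [Complex.ext_iff]

theorem twistPoint_succ (j : ℕ) :
    twistPoint n (j + 1) - twistPoint n j = (8 / (n - 1) : ℝ) * (1 + I) := by
  apply Complex.ext <;>
    simp only [twistPoint, sub_re, sub_im, mul_re, mul_im, add_re, add_im, one_re, one_im, I_re,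
      I_im, ofReal_re, ofReal_im] <;> push_cast <;> ring

end

section

variable {n : ℕ}

theorem IsModelEdge.endpoints (hn : 2 ≤ n) {x : ℕ} {E : ModelEdge} (h : IsModelEdge n x E) :
    (∃ z, IsModelVertex n z ∧ E.source = (z - (1 - I))⁻¹) ∧
      (E.target = 0 ∨ ∃ z, IsModelVertex n z ∧ E.target = (z - (1 - I))⁻¹) := by
  have h0 : IsModelVertex n (-8) := twistPoint_zero (n := n) ▸ .e 0 (by omega)
  have h1 : IsModelVertex n (8 * I) :=
    twistPoint_last (j := n - 1) hn (by omega) ▸ .e (n - 1) (by omega)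
  cases h with
  | outerLens | innerLens => exact ⟨⟨_, .a, rfl⟩, .inr ⟨_, .b, rfl⟩⟩
  | vertical => exact ⟨⟨_, .a, rfl⟩, .inr ⟨_, .c, rfl⟩⟩
  | horizontal => exact ⟨⟨_, .b, rfl⟩, .inr ⟨_, .c, rfl⟩⟩
  | rayRight | rayDown => exact ⟨⟨_, .c, rfl⟩, .inl rfl⟩
  | lowerArc => exact ⟨⟨_, .b, rfl⟩, .inr ⟨_, h0, rfl⟩⟩
  | upperArc => exact ⟨⟨_, .a, rfl⟩, .inr ⟨_, h1, rfl⟩⟩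
  | rayLeft => exact ⟨⟨_, h0, rfl⟩, .inl rfl⟩
  | rayUp => exact ⟨⟨_, h1, rfl⟩, .inl rfl⟩
  | twistInner j hj | twistOuter j hj =>
    exact ⟨⟨_, .e j (by omega), rfl⟩, .inr ⟨_, .e (j + 1) hj, rfl⟩⟩

theorem twistPoint_ne_succ (hn : 2 ≤ n) (j : ℕ) : twistPoint n j ≠ twistPoint n (j + 1) := by
  intro e
  have h := congrArg Complex.im e
  simp only [twistPoint] at h
  push_cast at h
  linarith [twist_step_pos hn]

theorem IsModelEdge.proper (hn : 2 ≤ n) {x : ℕ} {E : ModelEdge} (h : IsModelEdge n x E) :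
    E.Proper := by
  cases h with
  | twistInner j hj | twistOuter j hj =>
    exact ⟨(IsModelVertex.e j (by omega)).ne_pole hn, (IsModelVertex.e (j + 1) hj).ne_pole hn,
      twistPoint_ne_succ hn j, by simp [mem_slitPlane_iff]⟩
  | _ =>
    simp [ModelEdge.Proper, mem_slitPlane_iff, Complex.ext_iff]
    try norm_num

theorem re_im_of_mem_arcInterior {p q u z : ℂ} (h : z ∈ arcInterior p q u) :
    ∃ s : ℝ, 0 < s ∧
      z.re - p.re = s * (u.re * (q.re - z.re) - u.im * (q.im - z.im)) ∧
      z.im - p.im = s * (u.re * (q.im - z.im) + u.im * (q.re - z.re)) := by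
  obtain ⟨s, hs, e⟩ := h
  refine ⟨s, hs, ?_, ?_⟩
  · have := congrArg Complex.re e
    simp only [sub_re, sub_im, mul_re, mul_im, ofReal_re, ofReal_im] at this
    rw [this]; ring
  · have := congrArg Complex.im e
    simp only [sub_re, sub_im, mul_re, mul_im, ofReal_re, ofReal_im] at this
    rw [this]; ring

/-- The interior of an arc between consecutive points of the twist; `a`, `b` are the displacements
from its start. -/
theorem twist_arc_bounds {r s a b : ℝ} (hr : 0 < r) (hr8 : r ≤ 8) (hs : 0 < s)
    (ha : a = s * (r - a + (r - b))) (hb : b = s * (r - b - (r - a))) :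
    0 < a ∧ a < r ∧ 0 < b ∧ b < r ∧ b < a ∧ a < b + 4 := by
  have hD : 0 < 1 + 2 * s + 2 * s ^ 2 := by positivity
  have ha' : a = r * (2 * s + 2 * s ^ 2) / (1 + 2 * s + 2 * s ^ 2) := by
    rw [eq_div_iff hD.ne']
    linear_combination (1 + s) * ha - s * hb
  have hb' : b = r * (2 * s ^ 2) / (1 + 2 * s + 2 * s ^ 2) := by
    rw [eq_div_iff hD.ne']
    linear_combination (1 + s) * hb + s * ha
  have hrs : 0 < r * s := mul_pos hr hs
  refine ⟨?_, ?_, ?_, ?_, ?_, ?_⟩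
  · rw [ha']; positivity
  · rw [ha', div_lt_iff₀ hD]; nlinarith
  · rw [hb']; positivity
  · rw [hb', div_lt_iff₀ hD]; nlinarith
  · rw [ha', hb', div_lt_div_iff_of_pos_right hD]; nlinarith
  · rw [ha', hb', div_add' _ _ _ hD.ne', div_lt_div_iff_of_pos_right hD]
    nlinarith [sq_nonneg (2 * s - 1)]

theorem IsModelEdge.isZone (hn : 2 ≤ n) {x : ℕ} {E : ModelEdge} (h : IsModelEdge n x E) {z : ℂ}
    (hz : z ∈ E.interior) : IsZone n x z.re z.im := by
  cases h with
  | rayRight =>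
    obtain ⟨s, hs, e⟩ := hz
    rw [show z = s by linear_combination e]
    exact .rayRight rfl hs
  | rayDown =>
    obtain ⟨s, hs, e⟩ := hz
    rw [show z = -(s * I) by linear_combination e]
    exact .rayDown (by simp) (by simpa using hs)
  | rayLeft =>
    obtain ⟨s, hs, e⟩ := hz
    rw [show z = -8 - s by linear_combination e]
    exact .rayLeft (by simp) (by simpa using hs)
  | rayUp =>
    obtain ⟨s, hs, e⟩ := hz
    rw [show z = 8 * I + s * I by linear_combination e]
    exact .rayUp (by simp) (by simpa using hs)
  -- This is three quarters of the unit circle about `-1 + I`, where `y - x` is at most `2 + √2 <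
  -- 4`; hence it stays clear of the twist.
  | outerLens =>
    obtain ⟨s, hs, e₁, e₂⟩ := re_im_of_mem_arcInterior hz
    simp at e₁ e₂
    have hD : 0 < 1 - 2 * s + 2 * s ^ 2 := by nlinarith [sq_nonneg (1 - s), sq_nonneg s]
    have hx : z.re = -(2 * s ^ 2) / (1 - 2 * s + 2 * s ^ 2) := by
      rw [eq_div_iff hD.ne']; linear_combination (1 - s) * e₁ - s * e₂
    have hy : z.im = 1 / (1 - 2 * s + 2 * s ^ 2) := by
      rw [eq_div_iff hD.ne']; linear_combination (1 - s) * e₂ + s * e₁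
    refine .outerLens ?_ ?_ ?_ ?_
    · rw [hx]; exact div_neg_of_neg_of_pos (by nlinarith) hD
    · rw [hy]; positivity
    · rw [hx, hy, div_pow, div_pow, ← add_div, one_lt_div (by positivity)]
      nlinarith [mul_pos hD hs]
    · rw [hx, hy, ← sub_div, div_lt_iff₀ hD]
      nlinarith [sq_nonneg (3 * s - 2)]
  | innerLens =>
    obtain ⟨s, hs, e₁, e₂⟩ := re_im_of_mem_arcInterior hz
    simp at e₁ e₂
    have hD : 0 < 1 + 2 * s + 2 * s ^ 2 := by positivity
    have hx : z.re = -(2 * s + 2 * s ^ 2) / (1 + 2 * s + 2 * s ^ 2) := by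
      rw [eq_div_iff hD.ne']; linear_combination (1 + s) * e₁ - s * e₂
    have hy : z.im = (1 + 2 * s) / (1 + 2 * s + 2 * s ^ 2) := by
      rw [eq_div_iff hD.ne']; linear_combination (1 + s) * e₂ + s * e₁
    refine .innerLens ?_ ?_ ?_ ?_
    · rw [hx]; exact div_neg_of_neg_of_pos (by nlinarith) hD
    · rw [hy]; positivity
    · rw [hx, hy, div_pow, div_pow, ← add_div, div_eq_one_iff_eq (by positivity)]
      ring
    · rw [hx, hy, ← sub_div, div_lt_iff₀ hD]
      nlinarith
  | vertical =>
    obtain ⟨s, hs, e₁, e₂⟩ := re_im_of_mem_arcInterior hz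
    simp at e₁ e₂
    exact .vertical (by nlinarith) (by nlinarith) (by nlinarith)
  | horizontal =>
    obtain ⟨s, hs, e₁, e₂⟩ := re_im_of_mem_arcInterior hz
    simp at e₁ e₂
    exact .horizontal (by nlinarith) (by nlinarith) (by nlinarith)
  | lowerArc =>
    obtain ⟨s, hs, e₁, e₂⟩ := re_im_of_mem_arcInterior hz
    simp at e₁ e₂
    have hD : 0 < 1 + s ^ 2 := by positivity
    have hx : z.re = -(1 + 8 * s ^ 2) / (1 + s ^ 2) := by
      rw [eq_div_iff hD.ne']; linear_combination e₁ + s * e₂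
    have hy : z.im = -(7 * s) / (1 + s ^ 2) := by
      rw [eq_div_iff hD.ne']; linear_combination e₂ - s * e₁
    refine .lowerArc ?_ ?_
    · rw [hx]; exact div_neg_of_neg_of_pos (by nlinarith) hD
    · rw [hy]; exact div_neg_of_neg_of_pos (by nlinarith) hD
  | upperArc =>
    obtain ⟨s, hs, e₁, e₂⟩ := re_im_of_mem_arcInterior hz
    simp at e₁ e₂
    have hD : 0 < 1 + s ^ 2 := by positivity
    have hx : z.re = (7 * s) / (1 + s ^ 2) := by
      rw [eq_div_iff hD.ne']; linear_combination e₁ - s * e₂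
    have hy : z.im = (1 + 8 * s ^ 2) / (1 + s ^ 2) := by
      rw [eq_div_iff hD.ne']; linear_combination e₂ + s * e₁
    refine .upperArc ?_ ?_
    · rw [hx]; positivity
    · rw [hy]; positivity
  | twistInner j hj =>
    obtain ⟨s, hs, e₁, e₂⟩ := re_im_of_mem_arcInterior hz
    simp [twistPoint] at e₁ e₂
    have h1 := twist_step_pos hn
    have h2 : (8 : ℝ) / (n - 1) * (j + 1) ≤ 8 := by
      have := twist_step_mul_le hn (j := j + 1) hj
      push_cast at this
      exact this
    have h3 : (0 : ℝ) ≤ 8 / (n - 1) * j := mul_nonneg h1.le (Nat.cast_nonneg j)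
    rw [mul_add, mul_one] at h2
    generalize hr : (8 : ℝ) / (n - 1) = r at *
    obtain ⟨b1, b2, b3, b4, b5, b6⟩ := twist_arc_bounds (a := z.re + 8 - r * j) (b := z.im - r * j)
      h1 (by linarith) hs (by linear_combination e₁) (by linear_combination e₂)
    refine .twistInner j ?_ ?_ ?_ ?_ ?_ ?_ <;> (try rw [hr]) <;> linarith
  | twistOuter j hj =>
    obtain ⟨s, hs, e₁, e₂⟩ := re_im_of_mem_arcInterior hz
    simp [twistPoint] at e₁ e₂
    have h1 := twist_step_pos hn
    have h2 : (8 : ℝ) / (n - 1) * (j + 1) ≤ 8 := by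
      have := twist_step_mul_le hn (j := j + 1) hj
      push_cast at this
      exact this
    have h3 : (0 : ℝ) ≤ 8 / (n - 1) * j := mul_nonneg h1.le (Nat.cast_nonneg j)
    rw [mul_add, mul_one] at h2
    generalize hr : (8 : ℝ) / (n - 1) = r at *
    -- Reflection in the line `y = x + 8` exchanges the inner and outer arcs, hence the two
    -- displacements.
    obtain ⟨b1, b2, b3, b4, b5, b6⟩ := twist_arc_bounds (a := z.im - r * j) (b := z.re + 8 - r * j)
      h1 (by linarith) hs (by linear_combination e₂) (by linear_combination e₁)
    refine .twistOuter j ?_ ?_ ?_ ?_ ?_ <;> (try rw [hr]) <;> linarith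

theorem isModelEdge_flypedLabel (hn : 2 ≤ n) {i k : ℕ} (hi : i < n + 4) :
    IsModelEdge n (Code.flypedLabel n i k) (modelEdge n (Code.flypedLabel n i k)) := by
  suffices h : ∃ E, IsModelEdge n (Code.flypedLabel n i k) E by
    obtain ⟨E, h⟩ := h
    rwa [h.modelEdge_eq hn]
  have hin : ∀ j, j < n → ∃ E, IsModelEdge n (12 + 2 * j) E := fun j hj => by
    by_cases h : j + 1 < n
    · exact ⟨_, .twistInner j h⟩
    -- The edge leaving the last twist crossing is no longer part of a twist lens but the half
    -- circle back to vertex 0.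
    · rw [show 12 + 2 * j = 10 + 2 * n by omega]
      exact ⟨_, .upperArc⟩
  have hout : ∀ j, j < n → ∃ E, IsModelEdge n (13 + 2 * j) E := fun j hj => by
    by_cases h : j + 1 < n
    · exact ⟨_, .twistOuter j h⟩
    · rw [show 13 + 2 * j = 11 + 2 * n by omega]
      exact ⟨_, .rayUp⟩
  rcases i with _ | _ | _ | _ | j
  · rcases k with _ | _ | _ | k
    exacts [⟨_, .upperArc⟩, ⟨_, .outerLens⟩, ⟨_, .innerLens⟩, ⟨_, .vertical⟩]
  · rcases k with _ | _ | _ | k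
    exacts [⟨_, .outerLens⟩, ⟨_, .lowerArc⟩, ⟨_, .horizontal⟩, ⟨_, .innerLens⟩]
  · rcases k with _ | _ | _ | k
    exacts [⟨_, .vertical⟩, ⟨_, .horizontal⟩, ⟨_, .rayDown⟩, ⟨_, .rayRight⟩]
  · rcases k with _ | _ | _ | k
    exacts [⟨_, .rayRight⟩, ⟨_, .rayDown⟩, ⟨_, .rayLeft⟩, ⟨_, .rayUp⟩]
  · rcases k with _ | _ | _ | k
    · rcases j with _ | j
      · exact ⟨_, .lowerArc⟩
      · change ∃ E, IsModelEdge n (10 + 2 * (j + 1)) E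
        rw [show 10 + 2 * (j + 1) = 12 + 2 * j by ring]
        exact hin j (by omega)
    · exact hin j (by omega)
    · exact hout j (by omega)
    · rcases j with _ | j
      · exact ⟨_, .rayLeft⟩
      · change ∃ E, IsModelEdge n (11 + 2 * (j + 1)) E
        rw [show 11 + 2 * (j + 1) = 13 + 2 * j by ring]
        exact hout j (by omega)

end

/-! ### Angles at the vertices and assembly of the drawing -/

section

variable {n : ℕ}

/-- The finite vertex number `i` in the preimage of the drawing of `flypedFamily n`; vertex number
`3` lies at infinity. -/
noncomputable def modelVertex (n : ℕ) : ℕ → ℂ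
  | 0 => I
  | 1 => -1
  | 2 => 0
  | 3 => 0
  | j + 4 => twistPoint n j

/-- The direction in which the first end at a finite vertex leaves. -/
noncomputable def modelFrame : ℕ → ℂ
  | 0 => 1
  | 1 => -1
  | 2 => I
  | 3 => 1
  | _ + 4 => -I

/-- The vertex number `i` of the drawing of `flypedFamily n`. -/
noncomputable def vertexPosition (n i : ℕ) : ℂ :=
  if i = 3 then 0 else (modelVertex n i - (1 - I))⁻¹

theorem isModelVertex_modelVertex {i : ℕ} (hi : i < n + 4) : IsModelVertex n (modelVertex n i) := by
  rcases i with _ | _ | _ | _ | j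
  exacts [.a, .b, .c, .c, .e j (by omega)]

theorem modelVertex_injective (hn : 2 ≤ n) {i j : ℕ} (hi : i ≠ 3) (hj : j ≠ 3)
    (h : modelVertex n i = modelVertex n j) : i = j := by
  have hs := twist_step_pos hn
  have h1 := congrArg re h
  have h2 := congrArg im h
  rcases i with _ | _ | _ | _ | i <;> rcases j with _ | _ | _ | _ | j <;>
    simp only [modelVertex, twistPoint, I_re, I_im, neg_re, neg_im, one_re, one_im, zero_re,
      zero_im] at h1 h2
  all_goals first
    | rfl
    | exact absurd rfl hi
    | exact absurd rfl hj
    | (exfalso; linarith)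
    | skip
  have : (i : ℝ) = j := mul_left_cancel₀ hs.ne' h2
  rw [Nat.cast_injective this]

theorem vertexPosition_injective (hn : 2 ≤ n) {i j : ℕ} (hi : i < n + 4) (hj : j < n + 4)
    (h : vertexPosition n i = vertexPosition n j) : i = j := by
  have hi' := sub_ne_zero.2 ((isModelVertex_modelVertex hi).ne_pole hn)
  have hj' := sub_ne_zero.2 ((isModelVertex_modelVertex hj).ne_pole hn)
  unfold vertexPosition at h
  split_ifs at h with h1 h2 h2
  · rw [h1, h2]
  · exact absurd h.symm (inv_ne_zero hj')
  · exact absurd h (inv_ne_zero hi')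
  · exact modelVertex_injective hn h1 h2 (sub_left_injective (inv_injective h))

/-- An end at `p` leaves along `(q - p) * u`, an end at `q` along `(p - q) * u⁻¹`. In each case this
is an axis direction times the positive factor supplied, such as 7 for the half circles, whose end
points have distance 7. -/
theorem leaves_flypedLabel (hn : 2 ≤ n) {i k : ℕ} (hi : i < n + 4) (hk : k < 4) (h3 : i ≠ 3) :
    (modelEdge n (Code.flypedLabel n i k)).Leaves (modelVertex n i) (modelFrame i * I ^ k) := by
  have L : ∀ {E : ModelEdge} {i k x : ℕ}, IsModelEdge n x E → Code.flypedLabel n i k = x →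
      E.Leaves (modelVertex n i) (modelFrame i * I ^ k) →
      (modelEdge n (Code.flypedLabel n i k)).Leaves (modelVertex n i) (modelFrame i * I ^ k) :=
    fun h e hl => by rw [e, h.modelEdge_eq hn]; exact hl
  have hd : (1 - I : ℂ) ≠ 0 := by simp [Complex.ext_iff]
  have hd' : (1 + I : ℂ) ≠ 0 := by simp [Complex.ext_iff]
  have hd'' : (-1 - I : ℂ) ≠ 0 := by simp [Complex.ext_iff]
  have hI : I * I = -1 := I_mul_I
  have hs := twist_step_pos hn
  have hI3 : I ^ 3 = -I := I_pow_three
  have hI2 : I ^ 2 = -1 := I_sq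
  rcases i with _ | _ | _ | _ | j
  · interval_cases k
    · refine L .upperArc rfl ⟨7, by norm_num, .inl ⟨rfl, ?_⟩⟩
      simp only [modelFrame]; push_cast; linear_combination -7 * hI
    · refine L .outerLens rfl ⟨2, by norm_num, .inl ⟨rfl, ?_⟩⟩
      simp only [modelFrame]; push_cast; linear_combination hI
    · refine L .innerLens rfl ⟨2, by norm_num, .inl ⟨rfl, ?_⟩⟩
      simp only [modelFrame]; push_cast; linear_combination -hI
    · refine L .vertical rfl ⟨1, by norm_num, .inl ⟨rfl, ?_⟩⟩
      simp only [modelFrame]; push_cast; linear_combination -hI3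
  · interval_cases k
    · refine L .outerLens rfl ⟨1, by norm_num, .inr ⟨rfl, ?_⟩⟩
      simp only [modelFrame]; push_cast; field_simp; ring
    · refine L .lowerArc rfl ⟨7, by norm_num, .inl ⟨rfl, ?_⟩⟩
      simp only [modelFrame]; push_cast; ring
    · refine L .horizontal rfl ⟨1, by norm_num, .inl ⟨rfl, ?_⟩⟩
      simp only [modelFrame]; push_cast; linear_combination hI2
    · refine L .innerLens rfl ⟨1, by norm_num, .inr ⟨rfl, ?_⟩⟩
      simp only [modelFrame, hI3]; push_cast; field_simp; linear_combination hI
  · interval_cases k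
    · refine L .vertical rfl ⟨1, by norm_num, .inr ⟨rfl, ?_⟩⟩
      simp [modelFrame]
    · refine L .horizontal rfl ⟨1, by norm_num, .inr ⟨rfl, ?_⟩⟩
      simp [modelFrame]
    · refine L .rayDown rfl ⟨1, by norm_num, rfl, ?_⟩
      simp [modelFrame]
    · refine L .rayRight rfl ⟨1, by norm_num, rfl, ?_⟩
      simp [modelFrame]
  · omega
  · interval_cases k
    · rcases j with _ | j
      · refine L .lowerArc rfl ⟨7, by norm_num, .inr ⟨twistPoint_zero, ?_⟩⟩
        simp only [modelFrame, inv_I]; push_cast; ring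
      · refine L (.twistInner j (by omega)) (by simp only [Code.flypedLabel]; omega)
          ⟨8 / (n - 1), hs, .inr ⟨rfl, ?_⟩⟩
        have : twistPoint n j - twistPoint n (j + 1) = -((8 / (n - 1) : ℝ) * (1 + I)) := by
          rw [← twistPoint_succ]; ring
        rw [this]
        generalize (8 / (n - 1) : ℝ) = r
        simp only [modelFrame]; field_simp; linear_combination -(r : ℂ) * hI
    · by_cases h : j + 1 < n
      · refine L (.twistInner j h) rfl ⟨2 * (8 / (n - 1)), by positivity, .inl ⟨rfl, ?_⟩⟩
        rw [twistPoint_succ]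
        push_cast
        simp only [modelFrame]; ring_nf; simp [hI2]; ring
      · refine L .upperArc (by simp only [Code.flypedLabel]; omega)
          ⟨7, by norm_num, .inr ⟨twistPoint_last hn (by omega), ?_⟩⟩
        simp only [modelFrame, inv_neg, inv_I]; push_cast; ring
    · by_cases h : j + 1 < n
      · refine L (.twistOuter j h) rfl ⟨2 * (8 / (n - 1)), by positivity, .inl ⟨rfl, ?_⟩⟩
        rw [twistPoint_succ]
        push_cast
        simp only [modelFrame, hI2]; ring_nf; simp [hI2]
      · refine L .rayUp (by simp only [Code.flypedLabel]; omega)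
          ⟨1, by norm_num, twistPoint_last hn (by omega), ?_⟩
        simp [modelFrame]
    · rcases j with _ | j
      · refine L .rayLeft rfl ⟨1, by norm_num, twistPoint_zero, ?_⟩
        simp [modelFrame]
      · refine L (.twistOuter j (by omega)) (by simp only [Code.flypedLabel]; omega)
          ⟨8 / (n - 1), hs, .inr ⟨rfl, ?_⟩⟩
        have : twistPoint n j - twistPoint n (j + 1) = -((8 / (n - 1) : ℝ) * (1 + I)) := by
          rw [← twistPoint_succ]; ring
        rw [this]
        generalize (8 / (n - 1) : ℝ) = r
        simp only [modelFrame, hI3]; field_simp; linear_combination -(r : ℂ) * hI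

theorem nonempty_planeLombardiDrawing_flypedFamily (hn : 2 ≤ n) :
    Nonempty (PlaneLombardiDrawing (Code.flypedFamily n)) := by
  have hlt : ∀ i : Fin (Code.flypedFamily n).length, (i : ℕ) < n + 4 := fun i =>
    i.2.trans_eq (Code.length_flypedFamily n)
  have hE : ∀ (i : Fin (Code.flypedFamily n).length) (k : Fin 4),
      IsModelEdge n (Code.flypedLabel n i k) (modelEdge n (Code.flypedLabel n i k)) := fun i k =>
    isModelEdge_flypedLabel hn (hlt i)
  have hzone : ∀ (i : Fin (Code.flypedFamily n).length) (k : Fin 4) (w : ℂ),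
      w ∈ arcInterior (modelEdge n (Code.flypedLabel n i k)).source
        (modelEdge n (Code.flypedLabel n i k)).target
        (modelEdge n (Code.flypedLabel n i k)).direction →
      w ≠ 0 ∧ IsZone n (Code.flypedLabel n i k) (w⁻¹ + (1 - I)).re (w⁻¹ + (1 - I)).im :=
    fun i k w hw => by
      have h := ModelEdge.ne_zero_and_mem_interior ((hE i k).proper hn) hw
      exact ⟨h.1, (hE i k).isZone hn h.2⟩
  refine PlaneLombardiDrawing.nonempty_of_edges
    (lab := fun i k => Code.flypedLabel n i k) (pos := fun i => vertexPosition n i)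
    (P := fun x => (modelEdge n x).source) (Q := fun x => (modelEdge n x).target)
    (U := fun x => (modelEdge n x).direction)
    (fun i k => Code.endLabel_flypedFamily (hlt i) k.2)
    (fun i k m hkm => Code.flypedLabel_ne hn (hlt i) k.2 m.2 fun h => hkm (Fin.ext h))
    (fun i j h => Fin.ext (vertexPosition_injective hn (hlt i) (hlt j) h))
    (fun i k => ModelEdge.direction_mem_slitPlane ((hE i k).proper hn)
      fun h => not_isZone_pole ((hE i k).isZone hn h))
    (fun i k => ModelEdge.source_ne_target ((hE i k).proper hn))
    (fun i => ?_) (fun i j k m z hz => ?_) (fun i j k m hne z hz hz' => ?_)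
  · by_cases h3 : (i : ℕ) = 3
    · refine ⟨1, one_ne_zero, fun k => ⟨1, one_pos, Or.inr ?_⟩⟩
      -- A ray in direction `d` arrives at infinity so that its inverted image leaves `0` in
      -- direction `d⁻¹`. The directions `1, -I, -1, I` thus become `1, I, -1, -I`, which is the
      -- counterclockwise order.
      have hfin : ∀ {x : ℕ} {p d v : ℂ}, IsModelEdge n x (.ray p d) → d⁻¹ = v →
          vertexPosition n 3 = (modelEdge n x).target ∧
          ((modelEdge n x).source - (modelEdge n x).target) * (modelEdge n x).direction⁻¹ = v := by
        rintro x p d v hx rfl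
        have hp := sub_ne_zero.2 (hx.proper hn).1
        rw [hx.modelEdge_eq hn]
        refine ⟨rfl, ?_⟩
        simp only [ModelEdge.source, ModelEdge.target, ModelEdge.direction]
        generalize p - (1 - I) = a at *
        field_simp
        ring
      simp only [h3]
      fin_cases k
      · exact hfin .rayRight (by simp)
      · exact hfin .rayDown (by simp)
      · exact hfin .rayLeft (by simp [inv_neg])
      · exact hfin .rayUp (by simp)
    · have hv := sub_ne_zero.2 ((isModelVertex_modelVertex (hlt i)).ne_pole hn)
      refine ⟨-modelFrame i / (modelVertex n i - (1 - I)) ^ 2, ?_, fun k => ?_⟩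
      · refine div_ne_zero (neg_ne_zero.2 ?_) (pow_ne_zero 2 hv)
        rcases (i : ℕ) with _ | _ | _ | _ | j <;> simp [modelFrame]
      · have hl := (leaves_flypedLabel hn (hlt i) k.2 h3).inverted ((hE i k).proper hn)
        simp only [vertexPosition, if_neg h3]
        rwa [neg_mul_eq_neg_mul, mul_div_right_comm] at hl
  · obtain ⟨h0, h1⟩ := hzone i k z hz
    have hne : ∀ v, IsModelVertex n v → z ≠ (v - (1 - I))⁻¹ := by
      rintro v hv rfl
      rw [inv_inv, sub_add_cancel] at h1
      exact hv.not_isZone hn h1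
    obtain ⟨⟨v, hv, e⟩, h⟩ := (hE j m).endpoints hn
    refine ⟨fun h' => hne v hv (h'.trans e), fun h' => ?_⟩
    rcases h with h | ⟨v, hv, e⟩
    · exact h0 (h'.trans h)
    · exact hne v hv (h'.trans e)
  · exact hne ((hzone i k z hz).2.unique hn (hzone j m z hz').2)

end

end LombardiKnots

theorem mainTheorem11 (n : ℕ) (hn : 1 ≤ n) (h6 : 6 ≤ (LombardiKnots.family n).length) :
    ∃ D : LombardiKnots.Code, D.Equivalent (LombardiKnots.family n) ∧ D.IsLinkMultigraph ∧
      D.length = (LombardiKnots.family n).length ∧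
      Nonempty (LombardiKnots.PlaneLombardiDrawing D) := by
  have hlen : (LombardiKnots.family n).length = n + 4 := by
    simp [LombardiKnots.family]
  have hn2 : 2 ≤ n := by omega
  exact ⟨_, LombardiKnots.Code.equivalent_flypedFamily hn,
    LombardiKnots.Code.isLinkMultigraph_flypedFamily hn2,
    (LombardiKnots.Code.length_flypedFamily n).trans hlen.symm,
    LombardiKnots.nonempty_planeLombardiDrawing_flypedFamily hn2⟩
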